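/- Let $\mathbb{D}$ be the open unit disc, $A$ the area measure on $\mathbb{D}$ normalized by $A(\mathbb{D})=1$, and let $BMOA$ be the space of all analytic functions $f$ in $\mathbb{D}$ with $$\Vert f\Vert_*^2=|f(0)|^2+\sup_{\beta\in\mathbb{D}}\iint_{\mathbb{D}}\frac{1-|\beta|^2}{|1-\overline{\beta}z|^2}\,|f'(z)|^2\log\frac{1}{|z|}\,dA(z)<\infty ,$$ normed by $\Vert\cdot\Vert_*$. Let $BMOA_0=BMOA/\mathbb{C}$ be its quotient by the constant functions, with the quotient norm. Let $g\in H^\infty$, that is, let $g$ be a bounded analytic function in $\mathbb{D}$, and suppose that $g$ is not identically zero. Let $S_g:BMOA_0\to BMOA_0$ be the operator induced by $S_gf(z)=\int_0^z f'(w)g(w)\,dw$, $z\in\mathbb{D}$. For $c>0$ put $G_c=\{z\in\mathbb{D}:|g(z)|>c\}$, and for $a\in\mathbb{D}$, $\eta\in(0,1)$ put $D_\eta(a)=\{z\in\mathbb{D}:|(a-z)/(1-\overline{a}z)|<\eta\}$. Then the following are equivalent: (i) the operator $S_g:BMOA_0\to BMOA_0$ has closed range; (ii) there exist $c>0$, $\delta>0$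 and $\eta\in(0,1)$ such that $A(G_c\cap D_\eta(a))\ge\delta A(D_\eta(a))$ for all $a\in\mathbb{D}$. -/

import Mathlib

open MeasureTheory Metric Set
open scoped ENNReal ComplexConjugate

noncomputable section

namespace ClosedRange

/-- The open unit disc of the complex plane. -/
abbrev disc : Set ℂ := ball (0 : ℂ) 1

/-- Lebesgue area measure on the disc, normalized so that the disc has area `1`. -/
def area : Measure ℂ := (ENNReal.ofReal Real.pi)⁻¹ • (volume : Measure ℂ).restrict disc

/-- `g ∈ H^∞`: analytic and bounded in the disc (values of `g` off the disc are irrelevant). -/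
def MemHInf (g : ℂ → ℂ) : Prop :=
  DifferentiableOn ℂ g disc ∧ ∃ M : ℝ, ∀ z ∈ disc, ‖g z‖ ≤ M

/-- The pseudo-hyperbolic distance. -/
def rho (z w : ℂ) : ℝ := ‖(z - w) / (1 - conj z * w)‖

/-- The pseudo-hyperbolic disc of center `a` and radius `η`. -/
def pseudoDisc (η : ℝ) (a : ℂ) : Set ℂ := {z | z ∈ disc ∧ rho a z < η}

/-- The set `G_c` of the points of the disc where `|g| > c`. -/
def superlevel (g : ℂ → ℂ) (c : ℝ) : Set ℂ := {z | z ∈ disc ∧ c < ‖g z‖}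

/-- The weighted area integral
`∬ (1 - |β|²) / |1 - conj β z|² |f'(z)|² log (1 / |z|) dA(z)`, with values in `[0, ∞]`. -/
def garsiaIntegral (f : ℂ → ℂ) (β : ℂ) : ℝ≥0∞ :=
  ∫⁻ z, ENNReal.ofReal ((1 - ‖β‖ ^ 2) / ‖1 - conj β * z‖ ^ 2 * ‖deriv f z‖ ^ 2
    * Real.log (1 / ‖z‖)) ∂area

/-- The supremum over `β` in the disc of the weighted area integrals, with values in `[0, ∞]`. -/
def garsiaSup (f : ℂ → ℂ) : ℝ≥0∞ := ⨆ β ∈ disc, garsiaIntegral f β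

/-! ### Facts needed for the vector space and norm structure -/

/-- Square root of the integrand of `garsiaIntegral`. -/
def garsiaRoot (f : ℂ → ℂ) (β z : ℂ) : ℝ≥0∞ :=
  ENNReal.ofReal (√((1 - ‖β‖ ^ 2) / ‖1 - conj β * z‖ ^ 2 * Real.log (1 / ‖z‖)) * ‖deriv f z‖)

theorem ae_area {p : ℂ → Prop} (h : ∀ z ∈ disc, p z) : ∀ᵐ z ∂area, p z := by
  have h1 : ∀ᵐ z ∂((volume : Measure ℂ).restrict disc), p z := by
    filter_upwards [ae_restrict_mem measurableSet_ball] with z hz using h z hz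
  exact Measure.ae_smul_measure h1 _

theorem weight_nonneg {β z : ℂ} (hβ : β ∈ disc) (hz : z ∈ disc) :
    0 ≤ (1 - ‖β‖ ^ 2) / ‖1 - conj β * z‖ ^ 2 * Real.log (1 / ‖z‖) := by
  rw [mem_ball_zero_iff] at hβ hz
  have h1 : 0 ≤ 1 - ‖β‖ ^ 2 := by nlinarith [norm_nonneg β]
  have h2 : 0 ≤ Real.log (1 / ‖z‖) := by
    rw [one_div, Real.log_inv]
    linarith [Real.log_nonpos (norm_nonneg z) hz.le]
  positivity

theorem garsiaRoot_sq {f : ℂ → ℂ} {β z : ℂ} (hβ : β ∈ disc) (hz : z ∈ disc) :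
    garsiaRoot f β z ^ (2 : ℝ) = ENNReal.ofReal ((1 - ‖β‖ ^ 2) / ‖1 - conj β * z‖ ^ 2
      * ‖deriv f z‖ ^ 2 * Real.log (1 / ‖z‖)) := by
  unfold garsiaRoot
  rw [ENNReal.rpow_two, ← ENNReal.ofReal_pow (by positivity), mul_pow,
    Real.sq_sqrt (weight_nonneg hβ hz)]
  congr 1
  ring

theorem garsiaIntegral_eq (f : ℂ → ℂ) {β : ℂ} (hβ : β ∈ disc) :
    garsiaIntegral f β = ∫⁻ z, garsiaRoot f β z ^ (2 : ℝ) ∂area :=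
  lintegral_congr_ae (ae_area fun _ hz => (garsiaRoot_sq hβ hz).symm)

theorem measurable_garsiaRoot (f : ℂ → ℂ) (β : ℂ) : Measurable (garsiaRoot f β) := by
  have h := measurable_deriv f
  unfold garsiaRoot
  fun_prop

theorem garsiaSup_add_le {f h : ℂ → ℂ} (hf : DifferentiableOn ℂ f disc)
    (hh : DifferentiableOn ℂ h disc) :
    garsiaSup (f + h) ^ (1 / 2 : ℝ) ≤
      garsiaSup f ^ (1 / 2 : ℝ) + garsiaSup h ^ (1 / 2 : ℝ) := by
  rw [one_div, ENNReal.rpow_inv_le_iff (by norm_num)]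
  refine iSup₂_le fun β hβ => ?_
  rw [← ENNReal.rpow_inv_le_iff (by norm_num), ← one_div]
  calc garsiaIntegral (f + h) β ^ (1 / 2 : ℝ)
      ≤ (∫⁻ z, (garsiaRoot f β + garsiaRoot h β) z ^ (2 : ℝ) ∂area) ^ (1 / 2 : ℝ) := by
        rw [garsiaIntegral_eq _ hβ]
        refine ENNReal.rpow_le_rpow (lintegral_mono_ae (ae_area fun z hz => ?_)) (by norm_num)
        refine ENNReal.rpow_le_rpow ?_ (by norm_num)
        have hz' : disc ∈ nhds z := isOpen_ball.mem_nhds hz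
        rw [Pi.add_apply, garsiaRoot, garsiaRoot, garsiaRoot,
          deriv_add (hf.differentiableAt hz') (hh.differentiableAt hz'),
          ← ENNReal.ofReal_add (by positivity) (by positivity), ← mul_add]
        gcongr
        exact norm_add_le _ _
    _ ≤ garsiaIntegral f β ^ (1 / 2 : ℝ) + garsiaIntegral h β ^ (1 / 2 : ℝ) := by
        rw [garsiaIntegral_eq f hβ, garsiaIntegral_eq h hβ]
        exact ENNReal.lintegral_Lp_add_le (measurable_garsiaRoot f β).aemeasurable
          (measurable_garsiaRoot h β).aemeasurable (by norm_num)
    _ ≤ _ := by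
        have h1 : ∀ k : ℂ → ℂ, garsiaIntegral k β ≤ garsiaSup k :=
          fun k => le_iSup₂ (f := fun b (_ : b ∈ disc) => garsiaIntegral k b) β hβ
        exact add_le_add (ENNReal.rpow_le_rpow (h1 f) (by norm_num))
          (ENNReal.rpow_le_rpow (h1 h) (by norm_num))

/-- If `|F'| ≤ M |f'|` in the disc then `garsiaSup F ≤ M² garsiaSup f`. -/
theorem garsiaSup_le_mul {F f : ℂ → ℂ} {M : ℝ}
    (h : ∀ z ∈ disc, ‖deriv F z‖ ≤ M * ‖deriv f z‖) :
    garsiaSup F ≤ ENNReal.ofReal (M ^ 2) * garsiaSup f := by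
  refine iSup₂_le fun β hβ => ?_
  calc garsiaIntegral F β ≤ ENNReal.ofReal (M ^ 2) * garsiaIntegral f β := by
        unfold garsiaIntegral
        rw [← lintegral_const_mul' _ _ ENNReal.ofReal_ne_top]
        refine lintegral_mono_ae (ae_area fun z hz => ?_)
        rw [← ENNReal.ofReal_mul (by positivity)]
        apply ENNReal.ofReal_le_ofReal
        have h1 : ‖deriv F z‖ ^ 2 ≤ M ^ 2 * ‖deriv f z‖ ^ 2 := by
          rw [← mul_pow]; exact pow_le_pow_left₀ (norm_nonneg _) (h z hz) 2
        have := mul_le_mul_of_nonneg_left h1 (weight_nonneg hβ hz)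
        linarith
    _ ≤ _ := by
        gcongr
        exact le_iSup₂ (f := fun b (_ : b ∈ disc) => garsiaIntegral f b) β hβ

theorem garsiaSup_zero : garsiaSup 0 = 0 := by
  have h := garsiaSup_le_mul (F := 0) (f := 0) (M := 0) (fun z _ => by simp [Pi.zero_def])
  simpa using h

theorem garsiaSup_smul_le (c : ℂ) (f : ℂ → ℂ) :
    garsiaSup (c • f) ≤ ENNReal.ofReal (‖c‖ ^ 2) * garsiaSup f :=
  garsiaSup_le_mul fun z _ => by
    rw [deriv_const_smul_field, norm_smul]

/-- The analytic functions `f` in the disc with finite supremum of the weighted area integrals.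
A function in the disc is represented by its extension to `ℂ` by zero, so that two elements are
equal exactly when they agree in the disc. -/
def bmoaSubmodule : Submodule ℂ (ℂ → ℂ) where
  carrier := {f | DifferentiableOn ℂ f disc ∧ (∀ z, z ∉ disc → f z = 0) ∧ garsiaSup f < ∞}
  zero_mem' := ⟨differentiableOn_const 0, fun _ _ => rfl, by
    rw [garsiaSup_zero]; exact ENNReal.zero_lt_top⟩
  add_mem' := by
    rintro f h ⟨hf, hf0, hf1⟩ ⟨hh, hh0, hh1⟩
    refine ⟨hf.add hh, fun z hz => by simp [hf0 z hz, hh0 z hz], ?_⟩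
    have h2 := (garsiaSup_add_le hf hh).trans_lt (ENNReal.add_lt_top.2
      ⟨ENNReal.rpow_lt_top_of_nonneg (by norm_num) hf1.ne,
        ENNReal.rpow_lt_top_of_nonneg (by norm_num) hh1.ne⟩)
    exact (ENNReal.rpow_lt_top_iff_of_pos (by norm_num)).1 h2
  smul_mem' := by
    rintro c f ⟨hf, hf0, hf1⟩
    refine ⟨hf.const_smul c, fun z hz => by simp [hf0 z hz], ?_⟩
    exact (garsiaSup_smul_le c f).trans_lt (ENNReal.mul_lt_top ENNReal.ofReal_lt_top hf1)

/-- The space BMOA, as a type of its own: its only topology is that of the norm below, not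
the one of pointwise convergence that a subspace of `ℂ → ℂ` carries. -/
def BMOA : Type := bmoaSubmodule

instance : AddCommGroup BMOA := inferInstanceAs (AddCommGroup bmoaSubmodule)

instance : Module ℂ BMOA := inferInstanceAs (Module ℂ bmoaSubmodule)

/-- The function that an element of BMOA is. -/
def BMOA.fn (f : BMOA) : ℂ → ℂ := bmoaSubmodule.subtype f

theorem BMOA.mem (f : BMOA) : f.fn ∈ bmoaSubmodule := Subtype.prop (p := (· ∈ bmoaSubmodule)) f

theorem BMOA.ext {f h : BMOA} (H : ∀ z, f.fn z = h.fn z) : f = h :=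
  Subtype.ext (p := (· ∈ bmoaSubmodule)) (funext H)

theorem BMOA.fn_zero : (0 : BMOA).fn = 0 := rfl

theorem BMOA.fn_add (f h : BMOA) : (f + h).fn = f.fn + h.fn := rfl

theorem BMOA.fn_smul (c : ℂ) (f : BMOA) : (c • f).fn = c • f.fn := rfl

theorem BMOA.differentiableOn (f : BMOA) : DifferentiableOn ℂ f.fn disc := f.mem.1

theorem BMOA.fn_eq_zero (f : BMOA) : ∀ z, z ∉ disc → f.fn z = 0 := f.mem.2.1

theorem BMOA.garsiaSup_lt_top (f : BMOA) : garsiaSup f.fn < ∞ := f.mem.2.2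

/-- The element of BMOA given by a function. -/
def BMOA.ofFun (f : ℂ → ℂ) (hf : f ∈ bmoaSubmodule) : BMOA :=
  Subtype.mk (p := (· ∈ bmoaSubmodule)) f hf

theorem BMOA.fn_ofFun (f : ℂ → ℂ) (hf : f ∈ bmoaSubmodule) : (BMOA.ofFun f hf).fn = f := rfl

/-- The norm `‖f‖_* = (|f(0)|² + sup_β ∬ …)^{1/2}` of BMOA. -/
instance : Norm BMOA := ⟨fun f => √(‖f.fn 0‖ ^ 2 + (garsiaSup f.fn).toReal)⟩

theorem norm_def (f : BMOA) : ‖f‖ = √(‖f.fn 0‖ ^ 2 + (garsiaSup f.fn).toReal) := rfl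

theorem norm_smul_le' (c : ℂ) (f : BMOA) : ‖c • f‖ ≤ ‖c‖ * ‖f‖ := by
  have h := ENNReal.toReal_mono (ENNReal.mul_lt_top ENNReal.ofReal_lt_top f.garsiaSup_lt_top).ne
    (garsiaSup_smul_le c f.fn)
  rw [ENNReal.toReal_mul, ENNReal.toReal_ofReal (by positivity)] at h
  have e : ‖c‖ * ‖f‖ = √(‖c‖ ^ 2 * (‖f.fn 0‖ ^ 2 + (garsiaSup f.fn).toReal)) := by
    rw [Real.sqrt_mul (by positivity), Real.sqrt_sq (norm_nonneg c), norm_def]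
  rw [e, norm_def]
  apply Real.sqrt_le_sqrt
  have h1 : ‖(c • f).fn 0‖ = ‖c‖ * ‖f.fn 0‖ := norm_smul c (f.fn 0)
  rw [h1, mul_pow, mul_add]
  exact add_le_add le_rfl h

theorem norm_add_le' (f h : BMOA) : ‖f + h‖ ≤ ‖f‖ + ‖h‖ := by
  have key := garsiaSup_add_le f.differentiableOn h.differentiableOn
  have hf := f.garsiaSup_lt_top
  have hh := h.garsiaSup_lt_top
  have key2 : √(garsiaSup (f + h).fn).toReal ≤
      √(garsiaSup f.fn).toReal + √(garsiaSup h.fn).toReal := by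
    have := ENNReal.toReal_mono (ENNReal.add_lt_top.2
      ⟨ENNReal.rpow_lt_top_of_nonneg (by norm_num) hf.ne,
        ENNReal.rpow_lt_top_of_nonneg (by norm_num) hh.ne⟩).ne key
    rwa [ENNReal.toReal_add (ENNReal.rpow_lt_top_of_nonneg (by norm_num) hf.ne).ne
      (ENNReal.rpow_lt_top_of_nonneg (by norm_num) hh.ne).ne, ← ENNReal.toReal_rpow,
      ← ENNReal.toReal_rpow, ← ENNReal.toReal_rpow, ← Real.sqrt_eq_rpow, ← Real.sqrt_eq_rpow,
      ← Real.sqrt_eq_rpow] at this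
  have key3 : ‖(f + h).fn 0‖ ≤ ‖f.fn 0‖ + ‖h.fn 0‖ := norm_add_le _ _
  rw [norm_def, norm_def, norm_def]
  set a := ‖f.fn 0‖
  set b := ‖h.fn 0‖
  have e : ∀ k : BMOA, (garsiaSup k.fn).toReal = √(garsiaSup k.fn).toReal ^ 2 :=
    fun k => (Real.sq_sqrt ENNReal.toReal_nonneg).symm
  rw [e f, e h, e (f + h)]
  have hc : 0 ≤ √(garsiaSup f.fn).toReal := Real.sqrt_nonneg _
  have hd : 0 ≤ √(garsiaSup h.fn).toReal := Real.sqrt_nonneg _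
  have hs : 0 ≤ √(garsiaSup (f + h).fn).toReal := Real.sqrt_nonneg _
  set c := √(garsiaSup f.fn).toReal
  set d := √(garsiaSup h.fn).toReal
  set s := √(garsiaSup (f + h).fn).toReal
  have ha : 0 ≤ a := norm_nonneg _
  have hb : 0 ≤ b := norm_nonneg _
  have n1 := norm_add_le (⟨a, c⟩ : ℂ) ⟨b, d⟩
  have n2 : ∀ x y : ℝ, ‖(⟨x, y⟩ : ℂ)‖ = √(x ^ 2 + y ^ 2) := fun x y => by
    rw [Complex.norm_eq_sqrt_sq_add_sq]
  have n3 : (⟨a, c⟩ : ℂ) + ⟨b, d⟩ = ⟨a + b, c + d⟩ := rfl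
  rw [n3, n2, n2, n2] at n1
  refine le_trans (Real.sqrt_le_sqrt ?_) n1
  gcongr

theorem eq_zero_of_norm' (f : BMOA) (h : ‖f‖ = 0) : f = 0 := by
  rw [norm_def, Real.sqrt_eq_zero (by positivity)] at h
  have h0 : ‖f.fn 0‖ ^ 2 = 0 := by nlinarith [sq_nonneg ‖f.fn 0‖, ENNReal.toReal_nonneg (a := garsiaSup f.fn)]
  have h1 : (garsiaSup f.fn).toReal = 0 := by linarith
  have h2 : garsiaSup f.fn = 0 := by
    rcases (ENNReal.toReal_eq_zero_iff _).1 h1 with h | h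
    · exact h
    · exact absurd h f.garsiaSup_lt_top.ne
  have h3 : garsiaIntegral f.fn 0 = 0 := by
    have := le_iSup₂ (f := fun b (_ : b ∈ disc) => garsiaIntegral f.fn b) 0 (by simp)
    exact le_antisymm (this.trans h2.le) bot_le
  rw [garsiaIntegral_eq _ (by simp), lintegral_eq_zero_iff
    ((measurable_garsiaRoot _ _).pow_const _), area] at h3
  have hpi : (ENNReal.ofReal Real.pi)⁻¹ ≠ 0 := by simp
  rw [Filter.EventuallyEq] at h3
  have h4 : ∀ᵐ z ∂(volume : Measure ℂ).restrict disc, garsiaRoot f.fn 0 z ^ (2 : ℝ) = 0 :=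
    by
    rw [ae_iff] at h3 ⊢
    exact (mul_eq_zero.1 h3).resolve_left hpi
  have hcont : ContinuousOn (deriv f.fn) disc :=
    (f.differentiableOn.deriv isOpen_ball).continuousOn
  have h5 : ∀ᵐ z ∂(volume : Measure ℂ).restrict disc, deriv f.fn z = 0 := by
    have hne : ∀ᵐ z ∂(volume : Measure ℂ).restrict disc, z ≠ 0 :=
      ae_restrict_of_ae (Measure.ae_ne volume 0)
    filter_upwards [h4, ae_restrict_mem measurableSet_ball, hne] with z hz hzd hz0
    rw [garsiaRoot_sq (by simp) hzd, ENNReal.ofReal_eq_zero] at hz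
    have hz1 : ‖z‖ < 1 := by simpa using hzd
    have hlog : 0 < Real.log (1 / ‖z‖) :=
      Real.log_pos (by rw [lt_div_iff₀ (norm_pos_iff.2 hz0)]; linarith)
    simp only [norm_zero, map_zero, zero_mul, sub_zero, norm_one] at hz
    by_contra hd
    have : 0 < ‖deriv f.fn z‖ ^ 2 := by positivity
    have := mul_pos this hlog
    norm_num at hz
    norm_num at this
    linarith
  have h6 : EqOn (deriv f.fn) 0 disc :=
    Measure.eqOn_open_of_ae_eq h5 isOpen_ball hcont continuousOn_const
  have h7 : ∀ z ∈ disc, f.fn z = f.fn 0 := fun z hz =>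
    isOpen_ball.is_const_of_deriv_eq_zero (convex_ball (0 : ℂ) 1).isPreconnected f.differentiableOn h6 hz
      (by simp)
  refine BMOA.ext fun z => ?_
  by_cases hz : z ∈ disc
  · rw [h7 z hz, BMOA.fn_zero]; simpa using h0
  · exact f.fn_eq_zero z hz

instance : NormedAddCommGroup BMOA :=
  NormedAddCommGroup.ofCore (𝕜 := ℂ)
    { norm_nonneg := fun _ => Real.sqrt_nonneg _
      norm_smul := fun c f => by
        refine le_antisymm (norm_smul_le' c f) ?_
        by_cases hc : c = 0
        · subst hc
          rw [norm_zero, zero_mul]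
          exact Real.sqrt_nonneg _
        · have := norm_smul_le' c⁻¹ (c • f)
          rw [inv_smul_smul₀ hc, norm_inv] at this
          have hc' : 0 < ‖c‖ := norm_pos_iff.2 hc
          rwa [← div_eq_inv_mul, le_div_iff₀ hc', mul_comm] at this
      norm_triangle := norm_add_le'
      norm_eq_zero_iff := fun f => ⟨eq_zero_of_norm' f, fun h => by
        subst h
        rw [norm_def]
        simp [BMOA.fn_zero, garsiaSup_zero]⟩ }

instance : NormedSpace ℂ BMOA := ⟨norm_smul_le'⟩

/-- The constant functions, as a subspace of BMOA. -/
def constants : Submodule ℂ BMOA where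
  carrier := {f | ∃ c : ℂ, ∀ z ∈ disc, f.fn z = c}
  zero_mem' := ⟨0, fun _ _ => rfl⟩
  add_mem' := by
    rintro f h ⟨c, hc⟩ ⟨d, hd⟩
    exact ⟨c + d, fun z hz => by
      rw [← hc z hz, ← hd z hz]; rfl⟩
  smul_mem' := by
    rintro a f ⟨c, hc⟩
    exact ⟨a * c, fun z hz => by rw [← hc z hz]; rfl⟩

/-- The space `BMOA₀ = BMOA / ℂ`, with the quotient norm. -/
abbrev BMOA₀ : Type := BMOA ⧸ constants

/-- `S_g f (z) = ∫_0^z f'(w) g(w) dw` for `z` in the disc, the integral being taken along the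
segment `w = t z`, `0 ≤ t ≤ 1`; extended by zero off the disc. -/
def intOp (g f : ℂ → ℂ) : ℂ → ℂ :=
  disc.indicator fun z => ∫ t in (0 : ℝ)..1, deriv f (t * z) * g (t * z) * z

theorem mul_mem_disc {z : ℂ} (hz : z ∈ disc) {t : ℝ} (ht : t ∈ Icc (0 : ℝ) 1) :
    (t : ℂ) * z ∈ disc := by
  rw [mem_ball_zero_iff] at hz ⊢
  rw [norm_mul, Complex.norm_real, Real.norm_of_nonneg ht.1]
  nlinarith [ht.1, ht.2, norm_nonneg z]

theorem intOp_integrable {g f : ℂ → ℂ} (hg : DifferentiableOn ℂ g disc)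
    (hf : DifferentiableOn ℂ f disc) {z : ℂ} (hz : z ∈ disc) :
    IntervalIntegrable (fun t : ℝ => deriv f (t * z) * g (t * z) * z) volume 0 1 := by
  apply ContinuousOn.intervalIntegrable
  rw [uIcc_of_le zero_le_one]
  have hmaps : MapsTo (fun t : ℝ => (t : ℂ) * z) (Icc 0 1) disc := fun t ht => mul_mem_disc hz ht
  have hc : ContinuousOn (fun t : ℝ => (t : ℂ) * z) (Icc 0 1) := by fun_prop
  exact (((hf.deriv isOpen_ball).continuousOn.comp hc hmaps).mul
    (hg.continuousOn.comp hc hmaps)).mul continuousOn_const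

theorem hasDerivAt_intOp {g f : ℂ → ℂ} (hg : DifferentiableOn ℂ g disc)
    (hf : DifferentiableOn ℂ f disc) {z : ℂ} (hz : z ∈ disc) :
    HasDerivAt (intOp g f) (deriv f z * g z) z := by
  have hk : DifferentiableOn ℂ (fun w => deriv f w * g w) disc := (hf.deriv isOpen_ball).mul hg
  obtain ⟨F, hF⟩ := hk.isExactOn_ball
  have key : ∀ w ∈ disc, intOp g f w = F w - F 0 := by
    intro w hw
    rw [intOp, indicator_of_mem hw]
    have hd : ∀ t ∈ uIcc (0 : ℝ) 1, HasDerivAt (fun t : ℝ => F (t * w))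
        (deriv f (t * w) * g (t * w) * w) t := by
      intro t ht
      rw [uIcc_of_le zero_le_one] at ht
      have h1 : HasDerivAt (fun t : ℝ => (t : ℂ) * w) w t := by
        simpa using (Complex.ofRealCLM.hasDerivAt (x := t)).mul_const w
      exact (hF _ (mul_mem_disc hw ht)).comp t h1
    rw [intervalIntegral.integral_eq_sub_of_hasDerivAt hd (intOp_integrable hg hf hw)]
    simp
  have h1 : HasDerivAt (fun w => F w - F 0) (deriv f z * g z) z := (hF z hz).sub_const _
  refine h1.congr_of_eventuallyEq ?_
  filter_upwards [isOpen_ball.mem_nhds hz] with w hw using key w hw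

/-- The operator `S_g` on BMOA, for `g ∈ H^∞`. -/
def Sg (g : ℂ → ℂ) (hg : MemHInf g) : BMOA →ₗ[ℂ] BMOA where
  toFun f := BMOA.ofFun (intOp g f.fn) <| by
    obtain ⟨hg1, M, hM⟩ := hg
    refine ⟨fun z hz => (hasDerivAt_intOp hg1 f.differentiableOn hz).differentiableAt.differentiableWithinAt,
      fun z hz => indicator_of_notMem hz _, ?_⟩
    refine (garsiaSup_le_mul (M := M) (f := f.fn) fun z hz => ?_).trans_lt
      (ENNReal.mul_lt_top ENNReal.ofReal_lt_top f.garsiaSup_lt_top)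
    rw [(hasDerivAt_intOp hg1 f.differentiableOn hz).deriv, norm_mul, mul_comm]
    exact mul_le_mul_of_nonneg_right (hM z hz) (norm_nonneg _)
  map_add' f h := by
    refine BMOA.ext fun z => ?_
    by_cases hz : z ∈ disc
    · change intOp g (f.fn + h.fn) z = intOp g f.fn z + intOp g h.fn z
      rw [intOp, intOp, intOp, indicator_of_mem hz, indicator_of_mem hz, indicator_of_mem hz,
        ← intervalIntegral.integral_add (intOp_integrable hg.1 f.differentiableOn hz)
          (intOp_integrable hg.1 h.differentiableOn hz)]
      refine intervalIntegral.integral_congr fun t ht => ?_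
      rw [uIcc_of_le zero_le_one] at ht
      have hn := isOpen_ball.mem_nhds (mul_mem_disc hz ht)
      rw [deriv_add (f.differentiableOn.differentiableAt hn) (h.differentiableOn.differentiableAt hn)]
      ring
    · change intOp g (f.fn + h.fn) z = intOp g f.fn z + intOp g h.fn z
      simp [intOp, indicator_of_notMem hz]
  map_smul' c f := by
    refine BMOA.ext fun z => ?_
    by_cases hz : z ∈ disc
    · change intOp g (c • f.fn) z = c * intOp g f.fn z
      rw [intOp, intOp, indicator_of_mem hz, indicator_of_mem hz,
        ← intervalIntegral.integral_const_mul]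
      refine intervalIntegral.integral_congr fun t _ => ?_
      rw [deriv_const_smul_field, smul_eq_mul]
      ring
    · change intOp g (c • f.fn) z = c * intOp g f.fn z
      simp [intOp, indicator_of_notMem hz]

theorem constants_le_comap (g : ℂ → ℂ) (hg : MemHInf g) :
    constants ≤ constants.comap (Sg g hg) := by
  rintro f ⟨c, hc⟩
  refine ⟨0, fun z hz => ?_⟩
  change intOp g f.fn z = 0
  rw [intOp, indicator_of_mem hz]
  refine intervalIntegral.integral_zero_ae (Filter.Eventually.of_forall fun t ht => ?_)
  rw [uIoc_of_le zero_le_one] at ht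
  have hn := isOpen_ball.mem_nhds (mul_mem_disc hz ⟨ht.1.le, ht.2⟩)
  have : f.fn =ᶠ[nhds ((t : ℂ) * z)] fun _ => c := by
    filter_upwards [hn] with w hw using hc w hw
  rw [this.deriv_eq]
  simp

/-- The operator `S_g : BMOA₀ → BMOA₀`, for `g ∈ H^∞`. -/
def Sg₀ (g : ℂ → ℂ) (hg : MemHInf g) : BMOA₀ →ₗ[ℂ] BMOA₀ :=
  constants.mapQ constants (Sg g hg) (constants_le_comap g hg)

end ClosedRange

end

namespace ClosedRange

/-! Since (S_g f)' = f'g with g analytic and not identically zero, S_g is injective on BMOA₀. That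
space is a Banach space whose squared norm is `garsiaSup`, so by the open mapping theorem the range
is closed exactly when S_g is bounded below. It remains to compare this lower bound with the density
of G_c.

Density gives the lower bound. For fixed β the integral is a weighted Bergman norm of one analytic
function, `garsiaFun f β`, so a sampling inequality with constants independent of β suffices: the
norm over the disc is controlled by the norm over G_c, where |f'| ≤ |f'g|/c
(`exists_lintegral_le_of_isRelDense`). Its local form is |h(0)|² ≤ ε∫_B|h|² + C∫_E|h|² for E ⊆ B of
area at least m (`exists_norm_sq_le_lintegral_add`). This comes from Jensen's inequality: if |h|² is
small on average over E, then log|h|² is very negative there, and only a large mean square elsewhere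
can compensate. Automorphisms carry the estimate to every pseudo-hyperbolic disc; integrating over
the centres and absorbing the ε term gives the global inequality.

The lower bound gives density. The automorphisms φ_a have seminorm bounded away from 0 uniformly in
a (`le_garsiaSup_mobiusExt`). The measure |φ_a'|² dA is a probability measure that puts mass η² on
D_η(a). If G_c filled too little of D_η(a), then S_g φ_a would be too small
(`garsiaSup_intOp_mobiusExt_le`). -/

/-! ### Jensen's inequality and the local sampling estimate. -/

theorem ofReal_le_lintegral_ball_of_le_circleAverage {U : ℂ → ℝ} {η L : ℝ} (hη : 0 < η)
    (hU : ContinuousOn U (ball 0 η)) (h0 : ∀ z ∈ ball (0 : ℂ) η, 0 ≤ U z)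
    (hL : ∀ r ∈ Ioo 0 η, L ≤ Real.circleAverage U 0 r) :
    ENNReal.ofReal (Real.pi * η ^ 2 * L) ≤ ∫⁻ z in ball (0 : ℂ) η, ENNReal.ofReal (U z) := by
  rcases le_or_gt L 0 with hL0 | hL0
  · rw [ENNReal.ofReal_of_nonpos (mul_nonpos_of_nonneg_of_nonpos (by positivity) hL0)]
    exact bot_le
  classical
  set F : ℂ → ℝ≥0∞ := (ball (0 : ℂ) η).indicator fun z => ENNReal.ofReal (U z) with hF
  have hFm : Measurable F := by
    rw [hF, ← Set.piecewise_eq_indicator]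
    exact (ENNReal.continuous_ofReal.comp_continuousOn hU).measurable_piecewise
      continuousOn_const measurableSet_ball
  rw [← lintegral_indicator measurableSet_ball, ← hF, ← Complex.lintegral_comp_polarCoord_symm,
    polarCoord_target, Measure.volume_eq_prod, setLIntegral_prod]
  swap
  · have hc : Continuous fun p : ℝ × ℝ => Complex.polarCoord.symm p := by
      simp_rw [Complex.polarCoord_symm_apply]
      fun_prop
    exact ((ENNReal.measurable_ofReal.comp measurable_fst).mul
      (hFm.comp hc.measurable)).aemeasurable
  have inner : ∀ r ∈ Ioo 0 η, ENNReal.ofReal (r * (2 * Real.pi * L)) ≤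
      ∫⁻ θ in Ioo (-Real.pi) Real.pi,
        ENNReal.ofReal r • F (Complex.polarCoord.symm (r, θ)) := by
    intro r hr
    have hmem : ∀ θ, circleMap 0 r θ ∈ ball (0 : ℂ) η := fun θ => by
      simpa [abs_of_pos hr.1] using hr.2
    have hc : Continuous fun θ => U (circleMap 0 r θ) :=
      hU.comp_continuous (continuous_circleMap 0 r) hmem
    have e1 : ∀ θ, F (Complex.polarCoord.symm (r, θ)) = ENNReal.ofReal (U (circleMap 0 r θ)) := by
      intro θ
      have : Complex.polarCoord.symm (r, θ) = circleMap 0 r θ := by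
        rw [Complex.polarCoord_symm_apply, circleMap, zero_add, Complex.exp_mul_I]
        simp
      rw [this, hF, indicator_of_mem (hmem θ)]
    simp_rw [e1, smul_eq_mul]
    rw [lintegral_const_mul _ (hc.measurable.ennreal_ofReal),
      ENNReal.ofReal_mul hr.1.le]
    gcongr
    have hint : IntegrableOn (fun θ => U (circleMap 0 r θ)) (Ioo (-Real.pi) Real.pi) :=
      (hc.integrableOn_Icc).mono_set Ioo_subset_Icc_self
    rw [← ofReal_integral_eq_lintegral_ofReal hint
      (Filter.Eventually.of_forall fun θ => h0 _ (hmem θ))]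
    apply ENNReal.ofReal_le_ofReal
    have := hL r hr
    -- Polar coordinates use angles in (-π, π), while circle averages use [0, 2π]; periodicity
    -- permits the shift by -π.
    rw [Real.circleAverage_eq_integral_add (-Real.pi),
      intervalIntegral.integral_comp_add_right (fun θ => U (circleMap 0 r θ)), smul_eq_mul,
      inv_mul_eq_div, le_div_iff₀ (by positivity), zero_add,
      show 2 * Real.pi + -Real.pi = Real.pi by ring,
      intervalIntegral.integral_of_le (by linarith [Real.pi_pos]),
      integral_Ioc_eq_integral_Ioo] at this
    linarith
  calc ENNReal.ofReal (Real.pi * η ^ 2 * L)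
      = ∫⁻ r in Ioo 0 η, ENNReal.ofReal (r * (2 * Real.pi * L)) := by
        rw [← ofReal_integral_eq_lintegral_ofReal]
        · rw [← integral_Ioc_eq_integral_Ioo, ← intervalIntegral.integral_of_le hη.le,
            intervalIntegral.integral_mul_const, integral_id]
          congr 1
          ring
        · exact (Continuous.integrableOn_Icc (by fun_prop)).mono_set Ioo_subset_Icc_self
        · filter_upwards [ae_restrict_mem measurableSet_Ioo] with r hr
          have := hr.1
          simp only [Pi.zero_apply]
          positivity
    _ ≤ ∫⁻ r in Ioo 0 η, ∫⁻ θ in Ioo (-Real.pi) Real.pi,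
        ENNReal.ofReal r • F (Complex.polarCoord.symm (r, θ)) :=
        setLIntegral_mono' measurableSet_Ioo inner
    _ ≤ _ := lintegral_mono_set Ioo_subset_Ioi_self

/-- In Jensen's formula the zeros contribute nonnegative terms log(r/|u|). Truncating at 1 only
increases the right side, and makes the integrand continuous and nonnegative, as integration over
discs requires. -/
theorem log_norm_sq_le_circleAverage {h : ℂ → ℂ} (hd : DifferentiableOn ℂ h disc) {r : ℝ}
    (hr0 : 0 < r) (hr1 : r < 1) (h0 : h 0 ≠ 0) :
    Real.log (‖h 0‖ ^ 2) ≤ Real.circleAverage (fun z => Real.log (max (‖h z‖ ^ 2) 1)) 0 r := by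
  have hsub : closedBall (0 : ℂ) |r| ⊆ disc := by
    rw [abs_of_pos hr0]; exact closedBall_subset_ball hr1
  have hsph : sphere (0 : ℂ) |r| ⊆ disc := sphere_subset_closedBall.trans hsub
  have han : AnalyticOnNhd ℂ h (closedBall 0 |r|) := (hd.analyticOnNhd isOpen_ball).mono hsub
  have jensen := han.circleAverage_log_norm hr0.ne' h0
  have hnn : 0 ≤ ∑ᶠ u, (MeromorphicOn.divisor h (closedBall 0 |r|) u : ℝ) *
      Real.log (r * ‖0 - u‖⁻¹) := by
    refine finsum_nonneg fun u => ?_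
    by_cases hu : u ∈ closedBall (0 : ℂ) |r|
    · refine mul_nonneg ?_ ?_
      · exact_mod_cast MeromorphicOn.AnalyticOnNhd.divisor_nonneg han u
      · rcases eq_or_ne u 0 with rfl | hu0
        · simp
        · apply Real.log_nonneg
          rw [mem_closedBall_zero_iff, abs_of_pos hr0] at hu
          rw [zero_sub, norm_neg, ← div_eq_mul_inv, le_div_iff₀ (norm_pos_iff.2 hu0)]
          linarith
    · rw [Function.locallyFinsuppWithin.apply_eq_zero_of_notMem _ hu]; simp
  have hle : Real.log ‖h 0‖ ≤ Real.circleAverage (fun z => Real.log ‖h z‖) 0 r := by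
    rw [jensen]; linarith
  have hint : CircleIntegrable (fun z => Real.log ‖h z‖) 0 r :=
    (han.mono sphere_subset_closedBall).meromorphicOn.circleIntegrable_log_norm
  have e : ∀ z, Real.log (‖h z‖ ^ 2) = (2 : ℝ) • Real.log ‖h z‖ := fun z => by
    rw [Real.log_pow, smul_eq_mul]; norm_num
  calc Real.log (‖h 0‖ ^ 2) ≤ 2 * Real.circleAverage (fun z => Real.log ‖h z‖) 0 r := by
        rw [e, smul_eq_mul]; linarith
    _ = Real.circleAverage (fun z => (2 : ℝ) • Real.log ‖h z‖) 0 r := by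
        rw [Real.circleAverage_fun_smul, smul_eq_mul]
    _ ≤ _ := by
        refine Real.circleAverage_mono (hint.const_smul (a := (2 : ℝ))) ?_ ?_
        · apply ContinuousOn.circleIntegrable'
          have : ContinuousOn h (sphere 0 |r|) := hd.continuousOn.mono hsph
          refine ContinuousOn.log (by fun_prop) fun z _ => ?_
          exact (lt_max_of_lt_right one_pos).ne'
        · intro z _
          rw [← e]
          -- At a zero of `h` the convention log 0 = 0 keeps the inequality true, since the
          -- truncated logarithm is also 0.
          rcases eq_or_ne (h z) 0 with hz | hz
          · simp [hz]
          · exact Real.log_le_log (by positivity) (le_max_left _ _)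

theorem ofReal_log_norm_sq_le_lintegral {h : ℂ → ℂ} (hd : DifferentiableOn ℂ h disc) {η : ℝ}
    (hη0 : 0 < η) (hη1 : η < 1) (h0 : h 0 ≠ 0) {t : ℝ} (ht : 0 < t) :
    ENNReal.ofReal (η ^ 2 * Real.log (‖h 0‖ ^ 2 / t)) ≤
      ∫⁻ z in ball (0 : ℂ) η, ENNReal.ofReal (Real.log (max (‖h z‖ ^ 2 / t) 1)) ∂area := by
  have hsub : ball (0 : ℂ) η ⊆ disc := ball_subset_ball hη1.le
  -- The threshold `t` is reduced to 1 by rescaling `h`.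
  have e : ∀ z, ‖h z‖ ^ 2 / t = ‖((√t)⁻¹ : ℂ) * h z‖ ^ 2 := fun z => by
    rw [norm_mul, mul_pow, norm_inv, Complex.norm_real, Real.norm_of_nonneg (Real.sqrt_nonneg t),
      inv_pow, Real.sq_sqrt ht.le, inv_mul_eq_div]
  have hs : ((√t)⁻¹ : ℂ) ≠ 0 := inv_ne_zero (by exact_mod_cast (Real.sqrt_pos.2 ht).ne')
  have key := ofReal_le_lintegral_ball_of_le_circleAverage
    (U := fun z => Real.log (max (‖h z‖ ^ 2 / t) 1)) (L := Real.log (‖h 0‖ ^ 2 / t)) hη0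
    (by
      have : ContinuousOn h (ball 0 η) := hd.continuousOn.mono hsub
      exact ContinuousOn.log (by fun_prop) fun z _ => (lt_max_of_lt_right one_pos).ne')
    (fun z _ => Real.log_nonneg (le_max_right _ _))
    (fun r hr => by
      simp_rw [e]
      exact log_norm_sq_le_circleAverage (h := fun z => ((√t)⁻¹ : ℂ) * h z) (hd.const_mul _)
        hr.1 (hr.2.trans hη1) (mul_ne_zero hs h0))
  rw [area, Measure.restrict_smul, lintegral_smul_measure,
    Measure.restrict_restrict measurableSet_ball, inter_eq_self_of_subset_left hsub, smul_eq_mul,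
    mul_comm (_⁻¹), ← div_eq_mul_inv, ENNReal.le_div_iff_mul_le (by left; simp [Real.pi_pos])
    (by left; simp), ← ENNReal.ofReal_mul' Real.pi_pos.le]
  refine le_of_eq_of_le ?_ key
  congr 1
  ring

instance : IsProbabilityMeasure area := ⟨by
  rw [area, Measure.smul_apply, Measure.restrict_apply_univ, Complex.volume_ball, smul_eq_mul,
    ENNReal.ofReal_one, one_pow, one_mul, ← NNReal.coe_real_pi, ENNReal.ofReal_coe_nnreal,
    ENNReal.inv_mul_cancel (by simp [NNReal.pi_ne_zero]) (by simp)]⟩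

theorem area_ball {r : ℝ} (h0 : 0 ≤ r) (h1 : r ≤ 1) : area (ball 0 r) = ENNReal.ofReal (r ^ 2) := by
  rw [area, Measure.smul_apply, Measure.restrict_apply measurableSet_ball,
    inter_eq_self_of_subset_left (ball_subset_ball h1), Complex.volume_ball, smul_eq_mul,
    ← NNReal.coe_real_pi, ENNReal.ofReal_coe_nnreal, mul_comm, mul_assoc,
    ENNReal.mul_inv_cancel (by simp [NNReal.pi_ne_zero]) (by simp), mul_one, ENNReal.ofReal_pow h0]

/-- A point value of an analytic function is controlled by its mean square over a set `E` of
positive measure, up to a small multiple of its mean square over the whole disc. -/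
theorem exists_norm_sq_le_lintegral_add {η m ε : ℝ} (hη0 : 0 < η) (hη1 : η < 1) (hm : 0 < m)
    (hε : 0 < ε) : ∃ C : ℝ, 0 < C ∧ ∀ E : Set ℂ, MeasurableSet E → E ⊆ ball 0 η →
      ENNReal.ofReal m ≤ area E → ∀ h : ℂ → ℂ, DifferentiableOn ℂ h disc →
      ENNReal.ofReal (‖h 0‖ ^ 2) ≤
        ENNReal.ofReal ε * ∫⁻ z in ball (0 : ℂ) η, ENNReal.ofReal (‖h z‖ ^ 2) ∂area +
        ENNReal.ofReal C * ∫⁻ z in E, ENNReal.ofReal (‖h z‖ ^ 2) ∂area := by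
  -- If the claim fails, the logarithmic inequality with threshold e^{-ℓ}|h(0)|² yields ℓη² ≤ 1 +
  -- ℓ(η² - m) + 1/ε, that is ℓm ≤ 1 + 1/ε. The choice ℓm = 2 + 1/ε contradicts this.
  set ℓ : ℝ := (2 + 1 / ε) / m with hℓ
  have hℓ0 : 0 < ℓ := by positivity
  refine ⟨Real.exp ℓ, Real.exp_pos _, fun E hE hEB hmE h hd => ?_⟩
  by_contra! hlt
  set X := ∫⁻ z in E, ENNReal.ofReal (‖h z‖ ^ 2) ∂area
  set Y := ∫⁻ z in ball (0 : ℂ) η, ENNReal.ofReal (‖h z‖ ^ 2) ∂area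
  set s := ‖h 0‖ ^ 2 with hs
  have hY : ENNReal.ofReal ε * Y ≤ ENNReal.ofReal s := le_self_add.trans hlt.le
  have hX : ENNReal.ofReal (Real.exp ℓ) * X ≤ ENNReal.ofReal s := le_add_self.trans hlt.le
  have hs0 : 0 < s := ENNReal.ofReal_pos.1 (bot_le.trans_lt hlt)
  have h0 : h 0 ≠ 0 := fun h0 => by simp [hs, h0] at hs0
  have ht : 0 < Real.exp (-ℓ) * s := by positivity
  have key := ofReal_log_norm_sq_le_lintegral hd hη0 hη1 h0 ht
  have hst : s / (Real.exp (-ℓ) * s) = Real.exp ℓ := by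
    rw [div_mul_cancel_right₀ hs0.ne', Real.exp_neg, inv_inv]
  rw [← hs, hst, Real.log_exp] at key
  -- On `E` the bound log max(x, 1) ≤ x is enough, because the negated claim makes e^ℓ X ≤ s.
  have hEle : ∫⁻ z in E, ENNReal.ofReal (Real.log (max (‖h z‖ ^ 2 / (Real.exp (-ℓ) * s)) 1)) ∂area
      ≤ ENNReal.ofReal 1 := by
    calc _ ≤ ∫⁻ z in E, ENNReal.ofReal (Real.exp ℓ / s) * ENNReal.ofReal (‖h z‖ ^ 2) ∂area := by
          refine lintegral_mono fun z => ?_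
          rw [← ENNReal.ofReal_mul (by positivity)]
          apply ENNReal.ofReal_le_ofReal
          have e : ‖h z‖ ^ 2 / (Real.exp (-ℓ) * s) = Real.exp ℓ / s * ‖h z‖ ^ 2 := by
            rw [Real.exp_neg]; field_simp
          rw [e]
          have hn : 0 ≤ Real.exp ℓ / s * ‖h z‖ ^ 2 := by positivity
          refine (Real.log_le_sub_one_of_pos (lt_max_of_lt_right one_pos)).trans ?_
          rw [sub_le_iff_le_add]
          exact max_le (by linarith) (by linarith)
      _ = ENNReal.ofReal (1 / s) * (ENNReal.ofReal (Real.exp ℓ) * X) := by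
          rw [lintegral_const_mul' _ _ ENNReal.ofReal_ne_top, ← mul_assoc,
            ← ENNReal.ofReal_mul (by positivity)]
          congr 2
          ring
      _ ≤ ENNReal.ofReal (1 / s) * ENNReal.ofReal s := by gcongr
      _ = ENNReal.ofReal 1 := by
          rw [← ENNReal.ofReal_mul (by positivity), one_div_mul_cancel hs0.ne']
  -- Off `E`, with u = |h|²/s, one has log max(e^ℓ u, 1) ≤ ℓ + log(1 + u) ≤ ℓ + u. The large
  -- constant ℓ is paid only on area η² - m, and Y/s ≤ 1/ε.
  have hBle : ∫⁻ z in ball 0 η \ E,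
      ENNReal.ofReal (Real.log (max (‖h z‖ ^ 2 / (Real.exp (-ℓ) * s)) 1)) ∂area
      ≤ ENNReal.ofReal (ℓ * (η ^ 2 - m)) + ENNReal.ofReal (1 / ε) := by
    have hdiff : area (ball 0 η \ E) ≤ ENNReal.ofReal (η ^ 2 - m) := by
      rw [measure_sdiff hEB hE.nullMeasurableSet (measure_ne_top _ _),
        area_ball hη0.le hη1.le, ENNReal.ofReal_sub _ hm.le]
      gcongr
    calc _ ≤ ∫⁻ z in ball 0 η \ E, (ENNReal.ofReal ℓ +
            ENNReal.ofReal (1 / s) * ENNReal.ofReal (‖h z‖ ^ 2)) ∂area := by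
          refine lintegral_mono fun z => ?_
          rw [← ENNReal.ofReal_mul (by positivity), ← ENNReal.ofReal_add hℓ0.le (by positivity)]
          apply ENNReal.ofReal_le_ofReal
          have e : ‖h z‖ ^ 2 / (Real.exp (-ℓ) * s) = Real.exp ℓ * (1 / s * ‖h z‖ ^ 2) := by
            rw [Real.exp_neg]; field_simp
          rw [e]
          set u := 1 / s * ‖h z‖ ^ 2
          have hu : 0 ≤ u := by positivity
          have h1 : max (Real.exp ℓ * u) 1 ≤ Real.exp ℓ * (1 + u) := by
            have := Real.one_le_exp hℓ0.le
            exact max_le (by nlinarith) (by nlinarith)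
          refine (Real.log_le_log (lt_max_of_lt_right one_pos) h1).trans ?_
          rw [Real.log_mul (Real.exp_pos _).ne' (by positivity), Real.log_exp]
          linarith [Real.log_le_sub_one_of_pos (show 0 < 1 + u by positivity)]
      _ = ENNReal.ofReal ℓ * area (ball 0 η \ E) + ENNReal.ofReal (1 / s) *
            ∫⁻ z in ball 0 η \ E, ENNReal.ofReal (‖h z‖ ^ 2) ∂area := by
          rw [lintegral_add_left measurable_const, lintegral_const_mul' _ _ ENNReal.ofReal_ne_top,
            setLIntegral_const]
      _ ≤ ENNReal.ofReal ℓ * ENNReal.ofReal (η ^ 2 - m) + ENNReal.ofReal (1 / s) * Y := by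
          gcongr
          exact lintegral_mono_set sdiff_subset
      _ = ENNReal.ofReal (ℓ * (η ^ 2 - m)) +
            ENNReal.ofReal (1 / s * (1 / ε)) * (ENNReal.ofReal ε * Y) := by
          rw [ENNReal.ofReal_mul hℓ0.le, ← mul_assoc,
            ← ENNReal.ofReal_mul (p := 1 / s * (1 / ε)) (by positivity)]
          congr 3
          field_simp
      _ ≤ ENNReal.ofReal (ℓ * (η ^ 2 - m)) +
            ENNReal.ofReal (1 / s * (1 / ε)) * ENNReal.ofReal s := by gcongr
      _ = _ := by
          rw [← ENNReal.ofReal_mul (by positivity)]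
          congr 2
          field_simp
  have hηm : 0 ≤ η ^ 2 - m := by
    have := hmE.trans (measure_mono hEB)
    rw [area_ball hη0.le hη1.le, ENNReal.ofReal_le_ofReal_iff (by positivity)] at this
    linarith
  rw [← lintegral_inter_add_sdiff _ (ball (0 : ℂ) η) hE, inter_eq_self_of_subset_right hEB] at key
  have := key.trans (add_le_add hEle hBle)
  rw [← ENNReal.ofReal_add (by positivity) (by positivity),
    ← ENNReal.ofReal_add zero_le_one (by positivity),
    ENNReal.ofReal_le_ofReal_iff (by positivity)] at this
  have e : ℓ * m = 2 + 1 / ε := by rw [hℓ]; field_simp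
  nlinarith

/-! ### Automorphisms of the disc and pseudo-hyperbolic geometry. -/

/-- The involutive automorphism of the disc that exchanges `0` and `a`. -/
noncomputable def mobius (a z : ℂ) : ℂ := (a - z) / (1 - conj a * z)

/-- The modulus of the derivative of `mobius a`. -/
noncomputable def mobiusJac (a z : ℂ) : ℝ := (1 - ‖a‖ ^ 2) / ‖1 - conj a * z‖ ^ 2

theorem rho_eq (a z : ℂ) : rho a z = ‖mobius a z‖ := rfl

theorem one_sub_norm_sq_pos {z : ℂ} (hz : z ∈ disc) : 0 < 1 - ‖z‖ ^ 2 := by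
  rw [mem_ball_zero_iff] at hz
  nlinarith [norm_nonneg z]

theorem one_sub_norm_le {a z : ℂ} (hz : z ∈ disc) : 1 - ‖a‖ ≤ ‖1 - conj a * z‖ := by
  rw [mem_ball_zero_iff] at hz
  have h := norm_sub_norm_le (1 : ℂ) (conj a * z)
  rw [norm_one, norm_mul, Complex.norm_conj] at h
  nlinarith [norm_nonneg a]

theorem norm_one_sub_conj_mul_comm (a z : ℂ) : ‖1 - conj a * z‖ = ‖1 - conj z * a‖ := by
  rw [← Complex.norm_conj (1 - conj a * z)]
  simp [mul_comm]

theorem one_sub_conj_mul_ne_zero {a z : ℂ} (ha : a ∈ disc) (hz : z ∈ disc) :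
    1 - conj a * z ≠ 0 := by
  have h := one_sub_norm_le (a := a) hz
  rw [mem_ball_zero_iff] at ha
  intro h0
  rw [h0, norm_zero] at h
  linarith

theorem one_sub_norm_sq_le {a z : ℂ} (ha : a ∈ disc) (hz : z ∈ disc) :
    1 - ‖a‖ ^ 2 ≤ 2 * ‖1 - conj a * z‖ := by
  have h := one_sub_norm_le (a := a) hz
  rw [mem_ball_zero_iff] at ha
  nlinarith [norm_nonneg a]

/-- The source of the metric facts below: invariance of the disc, the formula for 1 - |φ_a|², and
the comparability of 1 - |a|² with 1 - |z|² inside a pseudo-hyperbolic disc. -/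
theorem norm_one_sub_sq (a z : ℂ) :
    ‖1 - conj a * z‖ ^ 2 - ‖a - z‖ ^ 2 = (1 - ‖a‖ ^ 2) * (1 - ‖z‖ ^ 2) := by
  simp only [← Complex.normSq_eq_norm_sq, Complex.normSq_apply, Complex.sub_re, Complex.sub_im,
    Complex.mul_re, Complex.mul_im, Complex.conj_re, Complex.conj_im, Complex.one_re,
    Complex.one_im]
  ring

theorem one_sub_norm_mobius_sq {a z : ℂ} (ha : a ∈ disc) (hz : z ∈ disc) :
    (1 - ‖mobius a z‖ ^ 2) * ‖1 - conj a * z‖ ^ 2 = (1 - ‖a‖ ^ 2) * (1 - ‖z‖ ^ 2) := by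
  have h := norm_pos_iff.2 (one_sub_conj_mul_ne_zero ha hz)
  rw [← norm_one_sub_sq, mobius, norm_div, div_pow, sub_mul, one_mul,
    div_mul_cancel₀ _ (by positivity)]

theorem mobius_mem {a z : ℂ} (ha : a ∈ disc) (hz : z ∈ disc) : mobius a z ∈ disc := by
  have h := norm_pos_iff.2 (one_sub_conj_mul_ne_zero ha hz)
  have h1 := one_sub_norm_mobius_sq ha hz
  have h2 := mul_pos (one_sub_norm_sq_pos ha) (one_sub_norm_sq_pos hz)
  rw [← h1] at h2
  have h3 := pos_of_mul_pos_left h2 (by positivity)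
  rw [mem_ball_zero_iff]
  nlinarith [norm_nonneg (mobius a z)]

theorem mobius_zero (a : ℂ) : mobius a 0 = a := by simp [mobius]

theorem mobius_mobius {a z : ℂ} (ha : a ∈ disc) (hz : z ∈ disc) :
    mobius a (mobius a z) = z := by
  have h := one_sub_conj_mul_ne_zero ha hz
  have ha2 := one_sub_conj_mul_ne_zero ha ha
  rw [mobius, div_eq_iff (one_sub_conj_mul_ne_zero ha (mobius_mem ha hz)), mobius]
  generalize conj a = b at h
  rw [mul_comm b z] at h ⊢
  field_simp
  ring

theorem hasDerivAt_mobius {a z : ℂ} (ha : a ∈ disc) (hz : z ∈ disc) :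
    HasDerivAt (mobius a) (-(1 - conj a * a) / (1 - conj a * z) ^ 2) z := by
  have h := one_sub_conj_mul_ne_zero ha hz
  have h1 : HasDerivAt (fun z => a - z) (-1) z := by simpa using (hasDerivAt_id z).const_sub a
  have h2 : HasDerivAt (fun z => 1 - conj a * z) (-conj a) z := by
    simpa using ((hasDerivAt_id z).const_mul (conj a)).const_sub 1
  convert! h1.div h2 h using 1
  congr 1
  ring

theorem norm_deriv_mobius {a z : ℂ} (ha : a ∈ disc) (hz : z ∈ disc) :
    ‖deriv (mobius a) z‖ = mobiusJac a z := by
  rw [(hasDerivAt_mobius ha hz).deriv, norm_div, norm_neg, norm_pow, mobiusJac]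
  congr 1
  have : 1 - conj a * a = ((1 - ‖a‖ ^ 2 : ℝ) : ℂ) := by
    rw [mul_comm, Complex.mul_conj, Complex.normSq_eq_norm_sq]; push_cast; ring
  rw [this, Complex.norm_real, Real.norm_of_nonneg (one_sub_norm_sq_pos ha).le]

theorem differentiableOn_mobius {a : ℂ} (ha : a ∈ disc) : DifferentiableOn ℂ (mobius a) disc :=
  fun _ hz => (hasDerivAt_mobius ha hz).differentiableAt.differentiableWithinAt

theorem mobiusJac_pos {a z : ℂ} (ha : a ∈ disc) (hz : z ∈ disc) : 0 < mobiusJac a z := by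
  have h := norm_pos_iff.2 (one_sub_conj_mul_ne_zero ha hz)
  have := one_sub_norm_sq_pos ha
  unfold mobiusJac
  positivity

theorem mobiusJac_mul_one_sub {a z : ℂ} (ha : a ∈ disc) (hz : z ∈ disc) :
    mobiusJac a z * (1 - ‖z‖ ^ 2) = 1 - ‖mobius a z‖ ^ 2 := by
  have h := norm_pos_iff.2 (one_sub_conj_mul_ne_zero ha hz)
  rw [mobiusJac, div_mul_eq_mul_div, div_eq_iff (by positivity), one_sub_norm_mobius_sq ha hz]

theorem mobiusJac_mul_one_sub_le {a z : ℂ} (ha : a ∈ disc) (hz : z ∈ disc) :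
    mobiusJac a z * (1 - ‖z‖ ^ 2) ≤ 1 := by
  rw [mobiusJac_mul_one_sub ha hz]
  linarith [sq_nonneg ‖mobius a z‖]

theorem mobiusJac_le {a z : ℂ} (ha : a ∈ disc) (hz : z ∈ disc) :
    mobiusJac a z ≤ 4 / (1 - ‖a‖ ^ 2) := by
  have h := norm_pos_iff.2 (one_sub_conj_mul_ne_zero ha hz)
  have h1 := one_sub_norm_sq_pos ha
  have h2 := one_sub_norm_sq_le ha hz
  rw [mobiusJac, div_le_div_iff₀ (by positivity) h1]
  nlinarith

theorem rho_comm (a z : ℂ) : rho a z = rho z a := by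
  rw [rho, rho, norm_div, norm_div, norm_one_sub_conj_mul_comm, norm_sub_rev]

/-- Points at pseudo-hyperbolic distance less than `η` are comparably far from the circle. -/
theorem one_sub_norm_sq_le_of_rho_lt {a z : ℂ} {η : ℝ} (ha : a ∈ disc) (hz : z ∈ disc)
    (hη1 : η < 1) (h : rho a z < η) :
    1 - ‖a‖ ^ 2 ≤ 4 / (1 - η ^ 2) * (1 - ‖z‖ ^ 2) := by
  have hη0 : 0 < η := (norm_nonneg _).trans_lt h
  have hη : 0 < 1 - η ^ 2 := by nlinarith
  have hn := norm_pos_iff.2 (one_sub_conj_mul_ne_zero ha hz)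
  have h1 := one_sub_norm_sq_pos ha
  have h2 := one_sub_norm_sq_le ha hz
  have h3 := one_sub_norm_mobius_sq ha hz
  rw [rho_eq] at h
  have h4 : 1 - η ^ 2 ≤ 1 - ‖mobius a z‖ ^ 2 := by nlinarith [norm_nonneg (mobius a z)]
  have h5 : (1 - η ^ 2) * (1 - ‖a‖ ^ 2) ^ 2 ≤ 4 * ((1 - ‖a‖ ^ 2) * (1 - ‖z‖ ^ 2)) := by
    rw [← h3]
    calc (1 - η ^ 2) * (1 - ‖a‖ ^ 2) ^ 2
        ≤ (1 - ‖mobius a z‖ ^ 2) * (2 * ‖1 - conj a * z‖) ^ 2 := by gcongr; linarith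
      _ = _ := by ring
  have h6 : (1 - η ^ 2) * (1 - ‖a‖ ^ 2) ≤ 4 * (1 - ‖z‖ ^ 2) :=
    le_of_mul_le_mul_left (by linarith) h1
  rw [div_mul_eq_mul_div, le_div_iff₀ hη]
  linarith

/-- Divide |φ_a'(z)|(1 - |z|²) = 1 - ρ² ≥ 1 - η² by 1 - |z|² ≤ 4(1 - |a|²)/(1 - η²), the
comparability with `a` and `z` exchanged. Together with `mobiusJac_le`, the derivative is of order
1/(1 - |a|²) throughout D_η(a). -/
theorem le_mobiusJac_of_rho_lt {a z : ℂ} {η : ℝ} (ha : a ∈ disc) (hz : z ∈ disc)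
    (hη1 : η < 1) (h : rho a z < η) :
    (1 - η ^ 2) ^ 2 / 4 / (1 - ‖a‖ ^ 2) ≤ mobiusJac a z := by
  have hη0 : 0 < η := (norm_nonneg _).trans_lt h
  have hη : 0 < 1 - η ^ 2 := by nlinarith
  have h1 := one_sub_norm_sq_pos ha
  have h2 := one_sub_norm_sq_pos hz
  have h3 := one_sub_norm_sq_le_of_rho_lt hz ha hη1 (by rwa [rho_comm])
  have h4 := mobiusJac_mul_one_sub ha hz
  have h5 : 1 - η ^ 2 ≤ 1 - ‖mobius a z‖ ^ 2 := by
    rw [rho_eq] at h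
    nlinarith [norm_nonneg (mobius a z)]
  have hK := mobiusJac_pos ha hz
  rw [div_mul_eq_mul_div, le_div_iff₀ hη] at h3
  rw [div_le_iff₀ h1]
  have h6 : (1 - η ^ 2) ^ 2 ≤ mobiusJac a z * (4 * (1 - ‖a‖ ^ 2)) := by
    calc (1 - η ^ 2) ^ 2 ≤ (mobiusJac a z * (1 - ‖z‖ ^ 2)) * (1 - η ^ 2) := by
          rw [h4]; nlinarith
      _ = mobiusJac a z * ((1 - ‖z‖ ^ 2) * (1 - η ^ 2)) := by ring
      _ ≤ _ := by gcongr
  linarith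

/-! ### Change of variables under automorphisms. -/

theorem lintegral_area (F : ℂ → ℝ≥0∞) :
    ∫⁻ z, F z ∂area = (ENNReal.ofReal Real.pi)⁻¹ * ∫⁻ z in disc, F z := by
  rw [area, lintegral_smul_measure, smul_eq_mul]

theorem det_restrictScalars_toSpanSingleton (d : ℂ) :
    ((ContinuousLinearMap.toSpanSingleton ℂ d).restrictScalars ℝ).det = ‖d‖ ^ 2 := by
  simp [ContinuousLinearMap.det, LinearMap.det_restrictScalars, Algebra.norm_complex_eq,
    Complex.normSq_eq_norm_sq]

/-- Change of variables under an automorphism of the disc. -/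
theorem lintegral_comp_mobius {a : ℂ} (ha : a ∈ disc) (F : ℂ → ℝ≥0∞) :
    ∫⁻ w, F (mobius a w) ∂area = ∫⁻ z, ENNReal.ofReal (mobiusJac a z ^ 2) * F z ∂area := by
  rw [lintegral_area, lintegral_area]
  congr 1
  have himg : mobius a '' disc = disc :=
    Subset.antisymm (image_subset_iff.2 fun z hz => mobius_mem ha hz)
      fun z hz => ⟨mobius a z, mobius_mem ha hz, mobius_mobius ha hz⟩
  have hinj : InjOn (mobius a) disc := fun z hz w hw h => by
    rw [← mobius_mobius ha hz, h, mobius_mobius ha hw]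
  conv_lhs => rw [← himg]
  rw [lintegral_image_eq_lintegral_abs_det_fderiv_mul volume measurableSet_ball
    (fun z hz => ((hasDerivAt_mobius ha hz).hasFDerivAt.restrictScalars ℝ).hasFDerivWithinAt) hinj]
  refine setLIntegral_congr_fun measurableSet_ball fun z hz => ?_
  rw [mobius_mobius ha hz, det_restrictScalars_toSpanSingleton, abs_of_nonneg (by positivity),
    ← (hasDerivAt_mobius ha hz).deriv, norm_deriv_mobius ha hz]

theorem measurable_mobius (a : ℂ) : Measurable (mobius a) := by
  unfold mobius
  fun_prop

theorem measurableSet_pseudoDisc (η : ℝ) (a : ℂ) : MeasurableSet (pseudoDisc η a) :=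
  measurableSet_ball.inter (measurableSet_lt (measurable_mobius a).norm measurable_const)

/-- As φ_a is an involution, ρ(a, φ_a(w)) = |w|, so φ_a exchanges the Euclidean disc of radius η
about 0 with D_η(a). -/
theorem setLIntegral_comp_mobius {a : ℂ} (ha : a ∈ disc) {η : ℝ} {P : Set ℂ}
    (hP : MeasurableSet P) (F : ℂ → ℝ≥0∞) :
    ∫⁻ w in ball 0 η ∩ mobius a ⁻¹' P, F (mobius a w) ∂area =
      ∫⁻ z in pseudoDisc η a ∩ P, ENNReal.ofReal (mobiusJac a z ^ 2) * F z ∂area := by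
  rw [← lintegral_indicator ((measurableSet_pseudoDisc η a).inter hP),
    ← lintegral_indicator (measurableSet_ball.inter (measurable_mobius a hP))]
  have h := lintegral_comp_mobius ha ((pseudoDisc η a ∩ P).indicator F)
  have e1 : ∀ w ∈ disc, (ball 0 η ∩ mobius a ⁻¹' P).indicator (fun w => F (mobius a w)) w =
      (pseudoDisc η a ∩ P).indicator F (mobius a w) := by
    intro w hw
    have hiff : w ∈ ball 0 η ∩ mobius a ⁻¹' P ↔ mobius a w ∈ pseudoDisc η a ∩ P := by
      simp [pseudoDisc, rho_eq, mobius_mobius ha hw, mem_ball_zero_iff.1 (mobius_mem ha hw)]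
    by_cases hw' : w ∈ ball 0 η ∩ mobius a ⁻¹' P
    · rw [indicator_of_mem hw', indicator_of_mem (hiff.1 hw')]
    · rw [indicator_of_notMem hw', indicator_of_notMem (fun h => hw' (hiff.2 h))]
  rw [lintegral_congr_ae (ae_area e1), h]
  refine lintegral_congr fun z => ?_
  by_cases hz : z ∈ pseudoDisc η a ∩ P <;> simp [hz]

theorem area_ball_inter_preimage {a : ℂ} (ha : a ∈ disc) {η : ℝ} {P : Set ℂ}
    (hP : MeasurableSet P) :
    area (ball 0 η ∩ mobius a ⁻¹' P) =
      ∫⁻ z in pseudoDisc η a ∩ P, ENNReal.ofReal (mobiusJac a z ^ 2) ∂area := by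
  simpa using setLIntegral_comp_mobius ha hP 1

theorem area_ball_inter_preimage_le {a : ℂ} (ha : a ∈ disc) {η : ℝ} {P : Set ℂ}
    (hP : MeasurableSet P) :
    area (ball 0 η ∩ mobius a ⁻¹' P) ≤
      ENNReal.ofReal ((4 / (1 - ‖a‖ ^ 2)) ^ 2) * area (pseudoDisc η a ∩ P) := by
  rw [area_ball_inter_preimage ha hP, ← setLIntegral_const]
  refine setLIntegral_mono' ((measurableSet_pseudoDisc η a).inter hP) fun z hz => ?_
  apply ENNReal.ofReal_le_ofReal
  exact pow_le_pow_left₀ (mobiusJac_pos ha hz.1.1).le (mobiusJac_le ha hz.1.1) 2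

theorem le_area_ball_inter_preimage {a : ℂ} (ha : a ∈ disc) {η : ℝ} (hη1 : η < 1) {P : Set ℂ}
    (hP : MeasurableSet P) :
    ENNReal.ofReal (((1 - η ^ 2) ^ 2 / 4 / (1 - ‖a‖ ^ 2)) ^ 2) * area (pseudoDisc η a ∩ P) ≤
      area (ball 0 η ∩ mobius a ⁻¹' P) := by
  rw [area_ball_inter_preimage ha hP, ← setLIntegral_const]
  refine setLIntegral_mono' ((measurableSet_pseudoDisc η a).inter hP) fun z hz => ?_
  apply ENNReal.ofReal_le_ofReal
  have := one_sub_norm_sq_pos ha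
  exact pow_le_pow_left₀ (by positivity) (le_mobiusJac_of_rho_lt ha hz.1.1 hη1 hz.1.2) 2

theorem lintegral_mobiusJac_sq {a : ℂ} (ha : a ∈ disc) :
    ∫⁻ z, ENNReal.ofReal (mobiusJac a z ^ 2) ∂area = 1 := by
  simpa using (lintegral_comp_mobius ha 1).symm

/-! ### Averaging over pseudo-hyperbolic discs and the sampling inequality. -/

theorem measurableSet_pseudoDisc_prod (η : ℝ) :
    MeasurableSet {p : ℂ × ℂ | p.2 ∈ disc ∧ rho p.1 p.2 < η} := by
  have h : Measurable fun p : ℂ × ℂ => rho p.1 p.2 := by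
    unfold rho
    fun_prop
  exact (measurable_snd measurableSet_ball).inter (measurableSet_lt h measurable_const)

/-- By Tonelli the centre `a` is integrated first. When ρ(a, z) < η, both 1 - |a|² and |φ_a'(z)|
cost at most a factor c = 4/(1 - η²) when replaced by 1 - |z|² and |φ_z'(a)|. This accounts for c³,
and |φ_z'(a)|² has integral 1 in `a`. -/
theorem lintegral_lintegral_pseudoDisc_le {η : ℝ} (hη1 : η < 1) {F : ℂ → ℝ≥0∞}
    (hF : Measurable F) :
    ∫⁻ a, ENNReal.ofReal (1 - ‖a‖ ^ 2) *
        ∫⁻ z in pseudoDisc η a, ENNReal.ofReal (mobiusJac a z ^ 2) * F z ∂area ∂area ≤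
      ENNReal.ofReal ((4 / (1 - η ^ 2)) ^ 3) *
        ∫⁻ z, ENNReal.ofReal (1 - ‖z‖ ^ 2) * F z ∂area := by
  rcases le_or_gt η 0 with hη0 | hη0
  · have : ∀ a, pseudoDisc η a = ∅ := fun a => by
      ext z
      simp only [pseudoDisc, mem_ofPred_eq, mem_empty_iff_false, iff_false, not_and, not_lt]
      exact fun _ => hη0.trans (norm_nonneg _)
    simp [this]
  have hη : 0 < 1 - η ^ 2 := by nlinarith
  set c := 4 / (1 - η ^ 2) with hc
  have hc0 : 0 < c := by positivity
  set Φ : ℂ → ℂ → ℝ≥0∞ := fun a z => {p : ℂ × ℂ | p.2 ∈ disc ∧ rho p.1 p.2 < η}.indicator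
    (fun p => ENNReal.ofReal (1 - ‖p.1‖ ^ 2) *
      (ENNReal.ofReal (mobiusJac p.1 p.2 ^ 2) * F p.2)) (a, z) with hΦ
  have hΦm : Measurable (Function.uncurry Φ) := by
    refine Measurable.indicator ?_ (measurableSet_pseudoDisc_prod η)
    unfold mobiusJac
    fun_prop
  calc _ = ∫⁻ a, ∫⁻ z, Φ a z ∂area ∂area := by
        refine lintegral_congr fun a => ?_
        rw [← lintegral_const_mul' _ _ ENNReal.ofReal_ne_top,
          ← lintegral_indicator (measurableSet_pseudoDisc η a)]
        rfl
    _ = ∫⁻ z, ∫⁻ a, Φ a z ∂area ∂area := lintegral_lintegral_swap hΦm.aemeasurable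
    _ ≤ ∫⁻ z, ENNReal.ofReal (c ^ 3) * (ENNReal.ofReal (1 - ‖z‖ ^ 2) * F z) ∂area := by
        refine lintegral_mono_ae (ae_area fun z hz => ?_)
        have hz1 := one_sub_norm_sq_pos hz
        calc ∫⁻ a, Φ a z ∂area
            ≤ ∫⁻ a, (ENNReal.ofReal (c ^ 3 * (1 - ‖z‖ ^ 2)) * F z) *
                ENNReal.ofReal (mobiusJac z a ^ 2) ∂area := by
              refine lintegral_mono_ae (ae_area fun a ha => ?_)
              by_cases hp : rho a z < η
              · have hmem : (a, z) ∈ {p : ℂ × ℂ | p.2 ∈ disc ∧ rho p.1 p.2 < η} := ⟨hz, hp⟩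
                simp only [hΦ]
                rw [indicator_of_mem hmem]
                have ha1 := one_sub_norm_sq_pos ha
                have h1 := one_sub_norm_sq_le_of_rho_lt ha hz hη1 hp
                -- The two derivatives have denominators of equal modulus, so only the numerators 1
                -- - |a|² and 1 - |z|² need comparing.
                have h2 : mobiusJac a z ≤ c * mobiusJac z a := by
                  rw [mobiusJac, mobiusJac, norm_one_sub_conj_mul_comm a z, ← mul_div_assoc]
                  gcongr
                have e : (ENNReal.ofReal (c ^ 3 * (1 - ‖z‖ ^ 2)) * F z) *
                    ENNReal.ofReal (mobiusJac z a ^ 2) =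
                    ENNReal.ofReal (c * (1 - ‖z‖ ^ 2)) *
                      (ENNReal.ofReal ((c * mobiusJac z a) ^ 2) * F z) := by
                  rw [mul_right_comm, ← mul_assoc, ← ENNReal.ofReal_mul (by positivity),
                    ← ENNReal.ofReal_mul (by positivity)]
                  congr 2
                  ring
                rw [e]
                have := mobiusJac_pos ha hz
                gcongr
              · have hmem : (a, z) ∉ {p : ℂ × ℂ | p.2 ∈ disc ∧ rho p.1 p.2 < η} := fun h => hp h.2
                simp only [hΦ]
                rw [indicator_of_notMem hmem]
                exact bot_le
          _ = ENNReal.ofReal (c ^ 3 * (1 - ‖z‖ ^ 2)) * F z := by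
              rw [lintegral_const_mul _ (by unfold mobiusJac; fun_prop),
                lintegral_mobiusJac_sq hz, mul_one]
          _ = _ := by rw [ENNReal.ofReal_mul (by positivity), mul_assoc]
    _ = _ := lintegral_const_mul' _ _ ENNReal.ofReal_ne_top

/-- The density condition on `P`: its proportion in every pseudo-hyperbolic disc of radius `η` is
at least `δ`. -/
def IsRelDense (P : Set ℂ) (δ η : ℝ) : Prop :=
  ∀ a ∈ disc, ENNReal.ofReal δ * area (pseudoDisc η a) ≤ area (P ∩ pseudoDisc η a)

/-- Density is transported to the disc about 0 with a constant free of `a`: the upper and lower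
bounds for |φ_a'| on D_η(a) are both of order 1/(1 - |a|²), and the powers of 1 - |a|² cancel. -/
theorem IsRelDense.le_area_ball {P : Set ℂ} {δ η : ℝ} (hP : MeasurableSet P) (hd : IsRelDense P δ η)
    (hη0 : 0 < η) (hη1 : η < 1) {a : ℂ} (ha : a ∈ disc) :
    ENNReal.ofReal ((1 - η ^ 2) ^ 4 / 256 * δ * η ^ 2) ≤ area (ball 0 η ∩ mobius a ⁻¹' P) := by
  have ha1 := one_sub_norm_sq_pos ha
  have h1 := area_ball_inter_preimage_le ha (η := η) MeasurableSet.univ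
  have h2 := le_area_ball_inter_preimage ha hη1 hP
  rw [preimage_univ, inter_univ, inter_univ, area_ball hη0.le hη1.le] at h1
  set N := 1 - ‖a‖ ^ 2
  set q := (1 - η ^ 2) ^ 2 / 4
  calc ENNReal.ofReal ((1 - η ^ 2) ^ 4 / 256 * δ * η ^ 2)
      = ENNReal.ofReal ((q / N) ^ 2 * (N / 4) ^ 2) * ENNReal.ofReal δ * ENNReal.ofReal (η ^ 2) := by
        rw [← ENNReal.ofReal_mul (by positivity), ← ENNReal.ofReal_mul' (by positivity)]
        congr 1
        simp only [q]
        field_simp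
        ring
    _ ≤ ENNReal.ofReal ((q / N) ^ 2 * (N / 4) ^ 2) * ENNReal.ofReal δ *
          (ENNReal.ofReal ((4 / N) ^ 2) * area (pseudoDisc η a)) := by gcongr
    _ = ENNReal.ofReal ((q / N) ^ 2) * (ENNReal.ofReal δ * area (pseudoDisc η a)) *
          (ENNReal.ofReal ((N / 4) ^ 2) * ENNReal.ofReal ((4 / N) ^ 2)) := by
        rw [ENNReal.ofReal_mul (by positivity)]
        ring
    _ = ENNReal.ofReal ((q / N) ^ 2) * (ENNReal.ofReal δ * area (pseudoDisc η a)) := by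
        rw [← ENNReal.ofReal_mul (by positivity), ← mul_pow, div_mul_div_comm, mul_comm N,
          div_self (by positivity), one_pow, ENNReal.ofReal_one, mul_one]
    _ ≤ ENNReal.ofReal ((q / N) ^ 2) * area (pseudoDisc η a ∩ P) := by
        rw [inter_comm _ P]
        gcongr
        exact hd a ha
    _ ≤ _ := h2

/-- The local estimate at 0 applied to h ∘ φ_a, whose value at 0 is h(a), with E the part of the
preimage of `P` in the disc of radius η. -/
theorem exists_norm_sq_le_pseudoDisc {δ η ε : ℝ} (hδ : 0 < δ) (hη0 : 0 < η) (hη1 : η < 1)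
    (hε : 0 < ε) : ∃ C : ℝ, 0 < C ∧ ∀ P : Set ℂ, MeasurableSet P → IsRelDense P δ η →
      ∀ h : ℂ → ℂ, DifferentiableOn ℂ h disc → ∀ a ∈ disc,
      ENNReal.ofReal (‖h a‖ ^ 2) ≤
        ENNReal.ofReal ε * ∫⁻ z in pseudoDisc η a,
          ENNReal.ofReal (mobiusJac a z ^ 2) * ENNReal.ofReal (‖h z‖ ^ 2) ∂area +
        ENNReal.ofReal C * ∫⁻ z in pseudoDisc η a ∩ P,
          ENNReal.ofReal (mobiusJac a z ^ 2) * ENNReal.ofReal (‖h z‖ ^ 2) ∂area := by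
  have hη : 0 < 1 - η ^ 2 := by nlinarith
  obtain ⟨C, hC, H⟩ := exists_norm_sq_le_lintegral_add hη0 hη1
    (m := (1 - η ^ 2) ^ 4 / 256 * δ * η ^ 2) (by positivity) hε
  refine ⟨C, hC, fun P hP hd h hh a ha => ?_⟩
  have key := H _ (measurableSet_ball.inter (measurable_mobius a hP)) inter_subset_left
    (hd.le_area_ball hP hη0 hη1 ha) (h ∘ mobius a)
    (hh.comp (differentiableOn_mobius ha) fun z hz => mobius_mem ha hz)
  have e1 := setLIntegral_comp_mobius ha (η := η) hP fun z => ENNReal.ofReal (‖h z‖ ^ 2)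
  have e2 := setLIntegral_comp_mobius ha (η := η) MeasurableSet.univ
    fun z => ENNReal.ofReal (‖h z‖ ^ 2)
  rw [preimage_univ, inter_univ, inter_univ] at e2
  simp only [Function.comp_apply, mobius_zero] at key
  rwa [e1, e2] at key

/-- Sampling inequality: the weighted Bergman norm of an analytic function is controlled by its
restriction to a set that satisfies the density condition. -/
theorem exists_lintegral_le_of_isRelDense {δ η : ℝ} (hδ : 0 < δ) (hη0 : 0 < η) (hη1 : η < 1) :
    ∃ C : ℝ, 0 < C ∧ ∀ P : Set ℂ, MeasurableSet P → IsRelDense P δ η →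
      ∀ h : ℂ → ℂ, DifferentiableOn ℂ h disc → Measurable h →
      ∫⁻ z, ENNReal.ofReal (1 - ‖z‖ ^ 2) * ENNReal.ofReal (‖h z‖ ^ 2) ∂area ≠ ∞ →
      ∫⁻ z, ENNReal.ofReal (1 - ‖z‖ ^ 2) * ENNReal.ofReal (‖h z‖ ^ 2) ∂area ≤ ENNReal.ofReal C *
        ∫⁻ z in P, ENNReal.ofReal (1 - ‖z‖ ^ 2) * ENNReal.ofReal (‖h z‖ ^ 2) ∂area := by
  have hη : 0 < 1 - η ^ 2 := by nlinarith
  set c := (4 / (1 - η ^ 2)) ^ 3 with hc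
  have hc0 : 0 < c := by positivity
  -- Averaging over the centres costs a factor `c`, so this ε leaves exactly half of the full
  -- integral to absorb.
  obtain ⟨C, hC, H⟩ := exists_norm_sq_le_pseudoDisc hδ hη0 hη1 (ε := 1 / (2 * c)) (by positivity)
  refine ⟨2 * (C * c), by positivity, fun P hP hd h hh hhm hfin => ?_⟩
  set v : ℂ → ℝ≥0∞ := fun z => ENNReal.ofReal (‖h z‖ ^ 2) with hv
  have hvm : Measurable v := by fun_prop
  change ∫⁻ z, ENNReal.ofReal (1 - ‖z‖ ^ 2) * v z ∂area ≤ _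
  set I := ∫⁻ z, ENNReal.ofReal (1 - ‖z‖ ^ 2) * v z ∂area with hI
  set J := ∫⁻ z in P, ENNReal.ofReal (1 - ‖z‖ ^ 2) * v z ∂area with hJ
  have hJ' : J = ∫⁻ z, ENNReal.ofReal (1 - ‖z‖ ^ 2) * P.indicator v z ∂area := by
    rw [hJ, ← lintegral_indicator hP]
    refine lintegral_congr fun z => ?_
    by_cases hz : z ∈ P <;> simp [hz]
  have hmeas : ∀ F : ℂ → ℝ≥0∞, Measurable F → Measurable fun a => ENNReal.ofReal (1 - ‖a‖ ^ 2) *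
      ∫⁻ z in pseudoDisc η a, ENNReal.ofReal (mobiusJac a z ^ 2) * F z ∂area := by
    intro F hF
    refine Measurable.mul (by fun_prop) ?_
    have hm : Measurable (Function.uncurry fun a z : ℂ =>
        {p : ℂ × ℂ | p.2 ∈ disc ∧ rho p.1 p.2 < η}.indicator
          (fun p => ENNReal.ofReal (mobiusJac p.1 p.2 ^ 2) * F p.2) (a, z)) := by
      refine Measurable.indicator ?_ (measurableSet_pseudoDisc_prod η)
      unfold mobiusJac
      fun_prop
    convert! hm.lintegral_prod_right' (ν := area) using 2 with a
    rw [← lintegral_indicator (measurableSet_pseudoDisc η a)]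
    rfl
  have main : I ≤ ENNReal.ofReal (1 / 2) * I + ENNReal.ofReal (C * c) * J := by
    calc I ≤ ∫⁻ a, (ENNReal.ofReal (1 / (2 * c)) * (ENNReal.ofReal (1 - ‖a‖ ^ 2) *
            ∫⁻ z in pseudoDisc η a, ENNReal.ofReal (mobiusJac a z ^ 2) * v z ∂area) +
          ENNReal.ofReal C * (ENNReal.ofReal (1 - ‖a‖ ^ 2) *
            ∫⁻ z in pseudoDisc η a, ENNReal.ofReal (mobiusJac a z ^ 2) * P.indicator v z ∂area))
          ∂area := by
          refine lintegral_mono_ae (ae_area fun a ha => ?_)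
          have key := H P hP hd h hh a ha
          have e : ∫⁻ z in pseudoDisc η a ∩ P,
              ENNReal.ofReal (mobiusJac a z ^ 2) * v z ∂area =
              ∫⁻ z in pseudoDisc η a, ENNReal.ofReal (mobiusJac a z ^ 2) * P.indicator v z ∂area := by
            rw [inter_comm, ← setLIntegral_indicator hP]
            refine lintegral_congr fun z => ?_
            by_cases hz : z ∈ P <;> simp [hz]
          change v a ≤ ENNReal.ofReal (1 / (2 * c)) * ∫⁻ z in pseudoDisc η a,
            ENNReal.ofReal (mobiusJac a z ^ 2) * v z ∂area + ENNReal.ofReal C *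
            ∫⁻ z in pseudoDisc η a ∩ P, ENNReal.ofReal (mobiusJac a z ^ 2) * v z ∂area at key
          rw [e] at key
          refine (mul_le_mul_right key (ENNReal.ofReal (1 - ‖a‖ ^ 2))).trans (le_of_eq ?_)
          ring
      _ ≤ ENNReal.ofReal (1 / (2 * c)) * (ENNReal.ofReal c * I) +
            ENNReal.ofReal C * (ENNReal.ofReal c * J) := by
          rw [lintegral_add_left ((hmeas v hvm).const_mul _),
            lintegral_const_mul' _ _ ENNReal.ofReal_ne_top,
            lintegral_const_mul' _ _ ENNReal.ofReal_ne_top, hJ']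
          gcongr
          · exact lintegral_lintegral_pseudoDisc_le hη1 hvm
          · exact lintegral_lintegral_pseudoDisc_le hη1 (hvm.indicator hP)
      _ = _ := by
          rw [← mul_assoc, ← mul_assoc, ← ENNReal.ofReal_mul (by positivity),
            ← ENNReal.ofReal_mul (by positivity)]
          congr 3
          field_simp
  have hhalf : ENNReal.ofReal (1 / 2) * I + ENNReal.ofReal (1 / 2) * I = I := by
    rw [← add_mul, ← ENNReal.ofReal_add (by positivity) (by positivity)]
    norm_num
  -- Cancelling half of `I` is legitimate only because `I` is finite.
  have hle : ENNReal.ofReal (1 / 2) * I ≤ ENNReal.ofReal (C * c) * J := by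
    refine ENNReal.le_of_add_le_add_left (a := ENNReal.ofReal (1 / 2) * I)
      (ENNReal.mul_ne_top ENNReal.ofReal_ne_top hfin) ?_
    rw [hhalf]
    exact main
  calc I = ENNReal.ofReal 2 * (ENNReal.ofReal (1 / 2) * I) := by
        rw [← mul_assoc, ← ENNReal.ofReal_mul (by positivity)]; norm_num
    _ ≤ ENNReal.ofReal 2 * (ENNReal.ofReal (C * c) * J) := by gcongr
    _ = _ := by rw [← mul_assoc, ← ENNReal.ofReal_mul (by positivity)]

/-! ### Comparison of the weights log(1/|z|) and 1 - |z|². -/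

theorem log_one_div_le {t : ℝ} (h0 : 0 ≤ t) (h1 : t ≤ 1) :
    Real.log (1 / t) ≤ 1 / t * (1 - t ^ 2) := by
  rcases h0.eq_or_lt with rfl | h
  · simp
  · refine (Real.log_le_sub_one_of_pos (by positivity)).trans ?_
    rw [div_mul_eq_mul_div, div_sub_one h.ne']
    gcongr
    nlinarith

theorem one_sub_sq_le_log {t : ℝ} (h0 : 0 < t) (h1 : t ≤ 1) :
    1 - t ^ 2 ≤ 2 * Real.log (1 / t) := by
  rw [one_div, Real.log_inv]
  nlinarith [Real.log_le_sub_one_of_pos h0]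

/-- In polar coordinates the Jacobian r cancels the singularity 1/r. This controls the logarithmic
weight near the origin. -/
theorem lintegral_ball_one_div_norm_le {s : ℝ} (h0 : 0 ≤ s) (h1 : s ≤ 1) :
    ∫⁻ z in ball (0 : ℂ) s, ENNReal.ofReal (1 / ‖z‖) ∂area ≤ ENNReal.ofReal (2 * s) := by
  have hsub : ball (0 : ℂ) s ⊆ disc := ball_subset_ball h1
  have hvol : ∫⁻ z in ball (0 : ℂ) s, ENNReal.ofReal (1 / ‖z‖) ≤
      ENNReal.ofReal (2 * Real.pi * s) := by
    rw [← lintegral_indicator measurableSet_ball, ← Complex.lintegral_comp_polarCoord_symm,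
      polarCoord_target]
    calc _ ≤ ∫⁻ p in Ioi (0 : ℝ) ×ˢ Ioo (-Real.pi) Real.pi,
            (Iio s ×ˢ univ).indicator (1 : ℝ × ℝ → ℝ≥0∞) p := by
          refine setLIntegral_mono' (measurableSet_Ioi.prod measurableSet_Ioo) fun p hp => ?_
          have hp0 : 0 < p.1 := hp.1
          have hn : ‖Complex.polarCoord.symm p‖ = p.1 := by
            rw [Complex.norm_polarCoord_symm, abs_of_pos hp0]
          by_cases hps : p.1 < s
          · rw [indicator_of_mem (by rwa [mem_ball_zero_iff, hn]),
              indicator_of_mem (by exact ⟨hps, mem_univ _⟩), hn, smul_eq_mul,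
              ← ENNReal.ofReal_mul hp0.le, mul_one_div_cancel hp0.ne']
            simp
          · rw [indicator_of_notMem (by rwa [mem_ball_zero_iff, hn])]
            simp
      _ = volume (Ioo (0 : ℝ) s ×ˢ Ioo (-Real.pi) Real.pi) := by
          rw [lintegral_indicator_one (measurableSet_Iio.prod MeasurableSet.univ),
            Measure.restrict_apply (measurableSet_Iio.prod MeasurableSet.univ), prod_inter_prod,
            univ_inter, inter_comm, Ioi_inter_Iio]
      _ ≤ _ := by
          rw [Measure.volume_eq_prod, Measure.prod_prod, Real.volume_Ioo, Real.volume_Ioo,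
            ← ENNReal.ofReal_mul (by linarith)]
          exact ENNReal.ofReal_le_ofReal (by linarith)
  rw [area, Measure.restrict_smul, lintegral_smul_measure,
    Measure.restrict_restrict measurableSet_ball, inter_eq_self_of_subset_left hsub, smul_eq_mul]
  calc _ ≤ (ENNReal.ofReal Real.pi)⁻¹ * ENNReal.ofReal (2 * Real.pi * s) := by gcongr
    _ = _ := by
      rw [← ENNReal.ofReal_inv_of_pos Real.pi_pos, ← ENNReal.ofReal_mul (by positivity)]
      congr 1
      field_simp

/-- The square of the norm in the weighted Bergman space with weight `1 - |z|²`. -/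
noncomputable def bergmanIntegral (h : ℂ → ℂ) : ℝ≥0∞ :=
  ∫⁻ z, ENNReal.ofReal (1 - ‖z‖ ^ 2) * ENNReal.ofReal (‖h z‖ ^ 2) ∂area

/-- Point evaluations are bounded on the weighted Bergman space, locally uniformly. -/
theorem exists_norm_sq_le_bergmanIntegral {r : ℝ} (hr : r < 1) : ∃ C : ℝ, 0 < C ∧
    ∀ h : ℂ → ℂ, DifferentiableOn ℂ h disc → ∀ a : ℂ, ‖a‖ ≤ r →
      ENNReal.ofReal (‖h a‖ ^ 2) ≤ ENNReal.ofReal C * bergmanIntegral h := by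
  rcases lt_or_ge r 0 with hr0 | hr0
  · exact ⟨1, one_pos, fun h _ a ha => absurd (ha.trans_lt hr0) (norm_nonneg a).not_gt⟩
  -- With `P` the whole plane the density condition is trivial with δ = 1, and the two terms merge
  -- into a mean-value estimate over D_{1/2}(a).
  obtain ⟨C, hC, H⟩ := exists_norm_sq_le_pseudoDisc (δ := 1) (η := 1 / 2) (ε := 1) one_pos
    (by norm_num) (by norm_num) one_pos
  have hR : 0 < 1 - r ^ 2 := by nlinarith
  set R := 1 - r ^ 2
  refine ⟨(1 + C) * ((4 / R) ^ 2 * (16 / 3 / R)), by positivity, fun h hh a har => ?_⟩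
  have ha : a ∈ disc := mem_ball_zero_iff.2 (har.trans_lt hr)
  have haR : R ≤ 1 - ‖a‖ ^ 2 := by
    simp only [R]
    nlinarith [norm_nonneg a]
  have key := H univ MeasurableSet.univ (fun a _ => by simp) h hh a ha
  rw [inter_univ, ← add_mul, ← ENNReal.ofReal_add zero_le_one hC.le] at key
  refine key.trans ?_
  rw [ENNReal.ofReal_mul (by positivity), mul_assoc, bergmanIntegral]
  refine mul_le_mul' le_rfl ?_
  rw [← lintegral_const_mul' _ _ ENNReal.ofReal_ne_top]
  refine (setLIntegral_mono' (measurableSet_pseudoDisc _ a) fun z hz => ?_).trans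
    (setLIntegral_le_lintegral _ _)
  rw [← mul_assoc, ← ENNReal.ofReal_mul (p := (4 / R) ^ 2 * (16 / 3 / R)) (by positivity)]
  gcongr
  have h1 := one_sub_norm_sq_le_of_rho_lt ha hz.1 (by norm_num) hz.2
  norm_num at h1
  have h2 := mobiusJac_le ha hz.1
  have h3 := (mobiusJac_pos ha hz.1).le
  have h4 : 1 ≤ 16 / 3 / R * (1 - ‖z‖ ^ 2) := by
    rw [div_mul_eq_mul_div, le_div_iff₀ hR]
    linarith
  have h5 : mobiusJac a z ≤ 4 / R := h2.trans (by gcongr)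
  calc mobiusJac a z ^ 2 ≤ (4 / R) ^ 2 * 1 := by rw [mul_one]; gcongr
    _ ≤ (4 / R) ^ 2 * (16 / 3 / R * (1 - ‖z‖ ^ 2)) := by gcongr
    _ = _ := by ring

/-- The same as `bergmanIntegral`, with the weight `log (1 / |z|)`. -/
noncomputable def logIntegral (h : ℂ → ℂ) : ℝ≥0∞ :=
  ∫⁻ z, ENNReal.ofReal (Real.log (1 / ‖z‖)) * ENNReal.ofReal (‖h z‖ ^ 2) ∂area

theorem ae_area_ne_zero : ∀ᵐ z ∂area, z ≠ 0 :=
  Measure.ae_smul_measure (ae_restrict_of_ae (Measure.ae_ne volume 0)) _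

theorem setLIntegral_one_sub_norm_sq_le (F : ℂ → ℝ≥0∞) (P : Set ℂ) :
    ∫⁻ z in P, ENNReal.ofReal (1 - ‖z‖ ^ 2) * F z ∂area ≤
      ENNReal.ofReal 2 * ∫⁻ z in P, ENNReal.ofReal (Real.log (1 / ‖z‖)) * F z ∂area := by
  rw [← lintegral_const_mul' _ _ ENNReal.ofReal_ne_top]
  refine lintegral_mono_ae (ae_restrict_of_ae ?_)
  filter_upwards [ae_area_ne_zero, ae_area (p := fun z => z ∈ disc) fun _ h => h] with z h0 hz
  rw [← mul_assoc, ← ENNReal.ofReal_mul zero_le_two]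
  gcongr
  exact one_sub_sq_le_log (norm_pos_iff.2 h0) (mem_ball_zero_iff.1 hz).le

theorem bergmanIntegral_le_logIntegral (h : ℂ → ℂ) :
    bergmanIntegral h ≤ ENNReal.ofReal 2 * logIntegral h := by
  have := setLIntegral_one_sub_norm_sq_le (fun z => ENNReal.ofReal (‖h z‖ ^ 2)) univ
  rwa [Measure.restrict_univ] at this

/-- Where |z| ≥ 1/2 the logarithmic weight is at most 2(1 - |z|²). No such pointwise bound holds
near 0, where analyticity enters: |h|² is bounded there by the Bergman norm, and 1/|z| is
integrable. -/
theorem exists_logIntegral_le : ∃ C : ℝ, 0 < C ∧ ∀ h : ℂ → ℂ, DifferentiableOn ℂ h disc →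
    logIntegral h ≤ ENNReal.ofReal C * bergmanIntegral h := by
  obtain ⟨C, hC, H⟩ := exists_norm_sq_le_bergmanIntegral (r := 1 / 2) (by norm_num)
  refine ⟨C + 2, by positivity, fun h hh => ?_⟩
  rw [logIntegral, ← lintegral_add_compl _ (measurableSet_ball (x := (0 : ℂ)) (ε := 1 / 2)),
    ENNReal.ofReal_add hC.le zero_le_two, add_mul]
  gcongr
  · calc _ ≤ ∫⁻ z in ball (0 : ℂ) (1 / 2),
          (ENNReal.ofReal C * bergmanIntegral h) * ENNReal.ofReal (1 / ‖z‖) ∂area := by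
          refine setLIntegral_mono' measurableSet_ball fun z hz => ?_
          rw [mem_ball_zero_iff] at hz
          rw [mul_comm]
          refine mul_le_mul' (H h hh z hz.le) (ENNReal.ofReal_le_ofReal ?_)
          refine (log_one_div_le (norm_nonneg z) (by linarith)).trans ?_
          exact mul_le_of_le_one_right (by positivity) (by nlinarith [norm_nonneg z])
      _ ≤ (ENNReal.ofReal C * bergmanIntegral h) * ENNReal.ofReal (2 * (1 / 2)) := by
          rw [lintegral_const_mul _ (by fun_prop)]
          gcongr
          exact lintegral_ball_one_div_norm_le (by norm_num) (by norm_num)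
      _ = _ := by norm_num
  · rw [bergmanIntegral, ← lintegral_const_mul' _ _ ENNReal.ofReal_ne_top]
    refine (lintegral_mono_ae ?_).trans (setLIntegral_le_lintegral (ball (0 : ℂ) (1 / 2))ᶜ _)
    filter_upwards [ae_restrict_mem measurableSet_ball.compl,
      ae_restrict_of_ae (ae_area (p := fun z => z ∈ disc) fun _ h => h)] with z hz hz1
    rw [mem_compl_iff, mem_ball_zero_iff, not_lt] at hz
    rw [← mul_assoc, ← ENNReal.ofReal_mul zero_le_two]
    gcongr
    refine (log_one_div_le (norm_nonneg z) (mem_ball_zero_iff.1 hz1).le).trans ?_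
    have := one_sub_norm_sq_pos hz1
    gcongr
    rw [div_le_iff₀ (by linarith)]
    linarith

/-! ### Density implies the lower bound. -/

/-- The analytic function whose squared modulus is `(1 - |β|²) / |1 - conj β z|² |f'(z)|²`. -/
noncomputable def garsiaFun (f : ℂ → ℂ) (β z : ℂ) : ℂ :=
  (√(1 - ‖β‖ ^ 2) : ℂ) / (1 - conj β * z) * deriv f z

theorem measurable_garsiaFun (f : ℂ → ℂ) (β : ℂ) : Measurable (garsiaFun f β) := by
  have h := measurable_deriv f
  unfold garsiaFun
  fun_prop

theorem differentiableOn_garsiaFun {f : ℂ → ℂ} (hf : DifferentiableOn ℂ f disc) {β : ℂ}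
    (hβ : β ∈ disc) : DifferentiableOn ℂ (garsiaFun f β) disc := by
  have h1 : DifferentiableOn ℂ (fun z => 1 - conj β * z) disc := by fun_prop
  exact ((differentiableOn_const _).div h1 fun z hz => one_sub_conj_mul_ne_zero hβ hz).mul
    (hf.deriv isOpen_ball)

theorem norm_garsiaFun_sq (f : ℂ → ℂ) {β : ℂ} (hβ : β ∈ disc) (z : ℂ) :
    ‖garsiaFun f β z‖ ^ 2 = (1 - ‖β‖ ^ 2) / ‖1 - conj β * z‖ ^ 2 * ‖deriv f z‖ ^ 2 := by
  rw [garsiaFun, norm_mul, norm_div, mul_pow, div_pow, Complex.norm_real, Real.norm_eq_abs, sq_abs,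
    Real.sq_sqrt (one_sub_norm_sq_pos hβ).le]

theorem garsiaIntegral_eq_logIntegral (f : ℂ → ℂ) {β : ℂ} (hβ : β ∈ disc) :
    garsiaIntegral f β = logIntegral (garsiaFun f β) := by
  refine lintegral_congr fun z => ?_
  rw [← norm_garsiaFun_sq f hβ, ENNReal.ofReal_mul (by positivity), mul_comm]

theorem garsiaIntegral_le_garsiaSup (f : ℂ → ℂ) {β : ℂ} (hβ : β ∈ disc) :
    garsiaIntegral f β ≤ garsiaSup f :=
  le_iSup₂ (f := fun b (_ : b ∈ disc) => garsiaIntegral f b) β hβ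

theorem measurableSet_superlevel {g : ℂ → ℂ} (hg : DifferentiableOn ℂ g disc) (c : ℝ) :
    MeasurableSet (superlevel g c) :=
  (hg.continuousOn.norm.isOpen_inter_preimage isOpen_ball isOpen_Ioi).measurableSet

/-- If the superlevel sets of `g` are dense in the sense of `IsRelDense`, then the operator
`f ↦ ∫ f' g` is bounded below. -/
theorem exists_garsiaSup_le_of_isRelDense {g : ℂ → ℂ} (hg : DifferentiableOn ℂ g disc)
    {c δ η : ℝ} (hc : 0 < c) (hδ : 0 < δ) (hη0 : 0 < η) (hη1 : η < 1)
    (hd : IsRelDense (superlevel g c) δ η) : ∃ K : ℝ, 0 < K ∧ ∀ f : ℂ → ℂ,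
      DifferentiableOn ℂ f disc → garsiaSup f < ∞ →
      garsiaSup f ≤ ENNReal.ofReal K * garsiaSup (intOp g f) := by
  obtain ⟨C₁, hC₁, H₁⟩ := exists_logIntegral_le
  obtain ⟨C₂, hC₂, H₂⟩ := exists_lintegral_le_of_isRelDense hδ hη0 hη1
  have hP := measurableSet_superlevel hg c
  refine ⟨C₁ * (C₂ * (2 * (1 / c ^ 2))), by positivity, fun f hf hfin => iSup₂_le fun β hβ => ?_⟩
  have hfinβ := (garsiaIntegral_le_garsiaSup f hβ).trans_lt hfin
  rw [garsiaIntegral_eq_logIntegral f hβ] at hfinβ ⊢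
  -- The sampling inequality needs a finite left side; this is where f ∈ BMOA is used.
  have hb : bergmanIntegral (garsiaFun f β) ≠ ∞ :=
    ((bergmanIntegral_le_logIntegral _).trans_lt
      (ENNReal.mul_lt_top ENNReal.ofReal_lt_top hfinβ)).ne
  have hgd := differentiableOn_garsiaFun hf hβ
  have h3 : ∫⁻ z in superlevel g c, ENNReal.ofReal (Real.log (1 / ‖z‖)) *
      ENNReal.ofReal (‖garsiaFun f β z‖ ^ 2) ∂area ≤
      ENNReal.ofReal (1 / c ^ 2) * garsiaIntegral (intOp g f) β := by
    rw [garsiaIntegral_eq_logIntegral _ hβ, logIntegral,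
      ← lintegral_const_mul' _ _ ENNReal.ofReal_ne_top]
    refine (setLIntegral_mono' hP fun z hz => ?_).trans (setLIntegral_le_lintegral _ _)
    rw [mul_left_comm, ← ENNReal.ofReal_mul (p := 1 / c ^ 2) (by positivity)]
    gcongr
    rw [norm_garsiaFun_sq _ hβ, norm_garsiaFun_sq _ hβ, (hasDerivAt_intOp hg hf hz.1).deriv,
      norm_mul, mul_pow]
    have h4 : 1 ≤ 1 / c ^ 2 * ‖g z‖ ^ 2 := by
      rw [div_mul_eq_mul_div, le_div_iff₀ (by positivity), one_mul, one_mul]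
      exact pow_le_pow_left₀ hc.le hz.2.le 2
    have h5 := (one_sub_norm_sq_pos hβ).le
    have h6 : 0 ≤ (1 - ‖β‖ ^ 2) / ‖1 - conj β * z‖ ^ 2 * ‖deriv f z‖ ^ 2 := by positivity
    calc _ ≤ (1 - ‖β‖ ^ 2) / ‖1 - conj β * z‖ ^ 2 * ‖deriv f z‖ ^ 2 *
          (1 / c ^ 2 * ‖g z‖ ^ 2) := le_mul_of_one_le_right h6 h4
      _ = _ := by ring
  calc logIntegral (garsiaFun f β) ≤ ENNReal.ofReal C₁ * bergmanIntegral (garsiaFun f β) :=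
        H₁ _ hgd
    _ ≤ ENNReal.ofReal C₁ * (ENNReal.ofReal C₂ * ∫⁻ z in superlevel g c,
          ENNReal.ofReal (1 - ‖z‖ ^ 2) * ENNReal.ofReal (‖garsiaFun f β z‖ ^ 2) ∂area) := by
        gcongr
        exact H₂ _ hP hd _ hgd (measurable_garsiaFun f β) hb
    _ ≤ ENNReal.ofReal C₁ * (ENNReal.ofReal C₂ * (ENNReal.ofReal 2 *
          (ENNReal.ofReal (1 / c ^ 2) * garsiaIntegral (intOp g f) β))) := by
        gcongr
        refine (setLIntegral_one_sub_norm_sq_le _ _).trans ?_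
        gcongr
    _ ≤ ENNReal.ofReal C₁ * (ENNReal.ofReal C₂ * (ENNReal.ofReal 2 *
          (ENNReal.ofReal (1 / c ^ 2) * garsiaSup (intOp g f)))) := by
        gcongr
        exact garsiaIntegral_le_garsiaSup _ hβ
    _ = _ := by
        rw [ENNReal.ofReal_mul hC₁.le, ENNReal.ofReal_mul hC₂.le, ENNReal.ofReal_mul zero_le_two]
        ring

/-! ### The lower bound implies density: automorphisms as test functions. -/

/-- `mobius a`, extended by zero off the disc. -/
noncomputable def mobiusExt (a : ℂ) : ℂ → ℂ := disc.indicator (mobius a)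

theorem hasDerivAt_mobiusExt {a z : ℂ} (ha : a ∈ disc) (hz : z ∈ disc) :
    HasDerivAt (mobiusExt a) (deriv (mobius a) z) z := by
  refine (hasDerivAt_mobius ha hz).differentiableAt.hasDerivAt.congr_of_eventuallyEq ?_
  filter_upwards [isOpen_ball.mem_nhds hz] with w hw using indicator_of_mem hw _

theorem differentiableOn_mobiusExt {a : ℂ} (ha : a ∈ disc) :
    DifferentiableOn ℂ (mobiusExt a) disc := fun _ hz =>
  (hasDerivAt_mobiusExt ha hz).differentiableAt.differentiableWithinAt

theorem norm_deriv_mobiusExt {a z : ℂ} (ha : a ∈ disc) (hz : z ∈ disc) :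
    ‖deriv (mobiusExt a) z‖ = mobiusJac a z := by
  rw [(hasDerivAt_mobiusExt ha hz).deriv, norm_deriv_mobius ha hz]

/-- The factor 1 - |z|² coming from the logarithm turns |φ_β'(z)| into 1 - |φ_β(z)|² ≤ 1, so the
bound is uniform in β. -/
theorem garsiaWeight_le {β z : ℂ} (hβ : β ∈ disc) (hz : z ∈ disc) :
    (1 - ‖β‖ ^ 2) / ‖1 - conj β * z‖ ^ 2 * Real.log (1 / ‖z‖) ≤ 1 / ‖z‖ := by
  change mobiusJac β z * Real.log (1 / ‖z‖) ≤ 1 / ‖z‖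
  calc _ ≤ mobiusJac β z * (1 / ‖z‖ * (1 - ‖z‖ ^ 2)) := by
        have := mobiusJac_pos hβ hz
        gcongr
        exact log_one_div_le (norm_nonneg z) (mem_ball_zero_iff.1 hz).le
    _ = 1 / ‖z‖ * (mobiusJac β z * (1 - ‖z‖ ^ 2)) := by ring
    _ ≤ _ := mul_le_of_le_one_right (by positivity) (mobiusJac_mul_one_sub_le hβ hz)

/-- Only membership in BMOA is needed here, so a crude bound depending on `a` is enough. -/
theorem garsiaSup_mobiusExt_lt_top {a : ℂ} (ha : a ∈ disc) : garsiaSup (mobiusExt a) < ∞ := by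
  have hN := one_sub_norm_sq_pos ha
  refine lt_of_le_of_lt (b := ENNReal.ofReal ((4 / (1 - ‖a‖ ^ 2)) ^ 2) * ENNReal.ofReal (2 * 1))
    (iSup₂_le fun β hβ => ?_) (ENNReal.mul_lt_top ENNReal.ofReal_lt_top ENNReal.ofReal_lt_top)
  calc garsiaIntegral (mobiusExt a) β
      ≤ ∫⁻ z, ENNReal.ofReal ((4 / (1 - ‖a‖ ^ 2)) ^ 2) *
          (ball (0 : ℂ) 1).indicator (fun z => ENNReal.ofReal (1 / ‖z‖)) z ∂area := by
        refine lintegral_mono_ae (ae_area fun z hz => ?_)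
        rw [indicator_of_mem hz, ← ENNReal.ofReal_mul (by positivity),
          norm_deriv_mobiusExt ha hz]
        apply ENNReal.ofReal_le_ofReal
        have h1 := (mobiusJac_pos ha hz).le
        calc _ = mobiusJac a z ^ 2 *
              ((1 - ‖β‖ ^ 2) / ‖1 - conj β * z‖ ^ 2 * Real.log (1 / ‖z‖)) := by ring
          _ ≤ (4 / (1 - ‖a‖ ^ 2)) ^ 2 * (1 / ‖z‖) := by
            gcongr
            · exact weight_nonneg hβ hz
            · exact mobiusJac_le ha hz
            · exact garsiaWeight_le hβ hz
    _ ≤ _ := by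
        rw [lintegral_const_mul' _ _ ENNReal.ofReal_ne_top, lintegral_indicator measurableSet_ball]
        gcongr
        exact lintegral_ball_one_div_norm_le zero_le_one le_rfl

/-- Take β = a: the integrand with weight 1 - |z|² is |φ_a'|³(1 - |z|²) = |φ_a'|²(1 - |φ_a|²), whose
integral is that of 1 - |w|², independent of `a`. The disc |w| < 1/2 alone contributes 3/4 · 1/4,
and passing to the logarithmic weight halves it. -/
theorem le_garsiaSup_mobiusExt {a : ℂ} (ha : a ∈ disc) :
    ENNReal.ofReal (3 / 32) ≤ garsiaSup (mobiusExt a) := by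
  have h1 : ENNReal.ofReal (3 / 4) * ENNReal.ofReal ((1 / 2) ^ 2) ≤
      ∫⁻ w, ENNReal.ofReal (1 - ‖w‖ ^ 2) ∂area := by
    rw [← area_ball (by norm_num) (by norm_num), ← setLIntegral_const]
    refine (setLIntegral_mono' measurableSet_ball fun w hw => ?_).trans
      (setLIntegral_le_lintegral _ _)
    apply ENNReal.ofReal_le_ofReal
    rw [mem_ball_zero_iff] at hw
    nlinarith [norm_nonneg w]
  have h2 : ∫⁻ w, ENNReal.ofReal (1 - ‖w‖ ^ 2) ∂area =
      ∫⁻ z, ENNReal.ofReal (mobiusJac a z ^ 2) * ENNReal.ofReal (1 - ‖mobius a z‖ ^ 2) ∂area := by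
    rw [← lintegral_comp_mobius ha fun z => ENNReal.ofReal (1 - ‖mobius a z‖ ^ 2)]
    exact lintegral_congr_ae (ae_area fun w hw => by simp only [mobius_mobius ha hw])
  have h3 : ∫⁻ z, ENNReal.ofReal (mobiusJac a z ^ 2) *
      ENNReal.ofReal (1 - ‖mobius a z‖ ^ 2) ∂area = bergmanIntegral (garsiaFun (mobiusExt a) a) := by
    refine lintegral_congr_ae (ae_area fun z hz => ?_)
    have := (mobiusJac_pos ha hz).le
    simp only
    rw [norm_garsiaFun_sq _ ha, norm_deriv_mobiusExt ha hz, ← mobiusJac_mul_one_sub ha hz,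
      ← ENNReal.ofReal_mul (by positivity), ← ENNReal.ofReal_mul (one_sub_norm_sq_pos hz).le]
    congr 1
    change _ = (1 - ‖z‖ ^ 2) * (mobiusJac a z * mobiusJac a z ^ 2)
    ring
  have h4 : ENNReal.ofReal (3 / 16) ≤ ENNReal.ofReal 2 * garsiaSup (mobiusExt a) := by
    calc ENNReal.ofReal (3 / 16) = ENNReal.ofReal (3 / 4) * ENNReal.ofReal ((1 / 2) ^ 2) := by
          rw [← ENNReal.ofReal_mul (by norm_num)]; norm_num
      _ ≤ bergmanIntegral (garsiaFun (mobiusExt a) a) := by rw [← h3, ← h2]; exact h1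
      _ ≤ ENNReal.ofReal 2 * logIntegral (garsiaFun (mobiusExt a) a) :=
          bergmanIntegral_le_logIntegral _
      _ ≤ _ := by
          rw [← garsiaIntegral_eq_logIntegral _ ha]
          gcongr
          exact garsiaIntegral_le_garsiaSup _ ha
  calc ENNReal.ofReal (3 / 32) = ENNReal.ofReal (1 / 2) * ENNReal.ofReal (3 / 16) := by
        rw [← ENNReal.ofReal_mul (by norm_num)]; norm_num
    _ ≤ ENNReal.ofReal (1 / 2) * (ENNReal.ofReal 2 * garsiaSup (mobiusExt a)) := by gcongr
    _ = _ := by rw [← mul_assoc, ← ENNReal.ofReal_mul (by norm_num)]; norm_num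

theorem mobiusJac_le_four {a z : ℂ} (ha : a ∈ disc) (hz : ‖z‖ ≤ 1 / 2) : mobiusJac a z ≤ 4 := by
  have hz1 : z ∈ disc := mem_ball_zero_iff.2 (by linarith)
  have h := one_sub_norm_le (a := z) ha
  rw [← norm_one_sub_conj_mul_comm] at h
  rw [mobiusJac, div_le_iff₀ (by nlinarith)]
  nlinarith [sq_nonneg ‖a‖]

theorem setLIntegral_compl_pseudoDisc {a : ℂ} (ha : a ∈ disc) {η : ℝ} (hη0 : 0 < η)
    (hη1 : η < 1) :
    ∫⁻ z in (pseudoDisc η a)ᶜ, ENNReal.ofReal (mobiusJac a z ^ 2) ∂area =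
      ENNReal.ofReal (1 - η ^ 2) := by
  have h1 := lintegral_add_compl (μ := area) (fun z => ENNReal.ofReal (mobiusJac a z ^ 2))
    (measurableSet_pseudoDisc η a)
  have h2 := area_ball_inter_preimage ha (η := η) MeasurableSet.univ
  rw [preimage_univ, inter_univ, inter_univ, area_ball hη0.le hη1.le] at h2
  rw [← h2, lintegral_mobiusJac_sq ha] at h1
  rw [ENNReal.ofReal_sub _ (by positivity), ENNReal.ofReal_one]
  exact ENNReal.eq_sub_of_add_eq ENNReal.ofReal_ne_top (by rwa [add_comm])

/-- The disc is covered by four sets, one per term. For |z| < s, |φ_a'| ≤ 4 and the weight is at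
most 1/|z|. For |z| ≥ s the weight is at most 1/s, and |φ_a'|² dA is integrated over the points with
|g| ≤ c, over the complement of D_η(a), and over D_η(a) ∩ G_c. -/
theorem garsiaSup_intOp_mobiusExt_le {g : ℂ → ℂ} (hg : DifferentiableOn ℂ g disc) {M : ℝ}
    (hM : ∀ z ∈ disc, ‖g z‖ ≤ M) {a : ℂ} (ha : a ∈ disc) {s c η : ℝ} (hs0 : 0 < s)
    (hs1 : s ≤ 1 / 2) (hη0 : 0 < η) (hη1 : η < 1) :
    garsiaSup (intOp g (mobiusExt a)) ≤ ENNReal.ofReal (16 * M ^ 2 * (2 * s)) +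
      ENNReal.ofReal (c ^ 2 / s) + ENNReal.ofReal (M ^ 2 / s * (1 - η ^ 2)) +
      ENNReal.ofReal (M ^ 2 / s) * area (ball 0 η ∩ mobius a ⁻¹' superlevel g c) := by
  have hP := measurableSet_superlevel hg c
  have hD := measurableSet_pseudoDisc η a
  refine iSup₂_le fun β hβ => ?_
  set k : ℂ → ℝ≥0∞ := fun z => ENNReal.ofReal (mobiusJac a z ^ 2) with hk
  have hkm : Measurable k := by simp only [hk, mobiusJac]; fun_prop
  have hpt : ∀ z ∈ disc, ENNReal.ofReal ((1 - ‖β‖ ^ 2) / ‖1 - conj β * z‖ ^ 2 *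
      ‖deriv (intOp g (mobiusExt a)) z‖ ^ 2 * Real.log (1 / ‖z‖)) ≤
      ENNReal.ofReal (16 * M ^ 2) * (ball (0 : ℂ) s).indicator
        (fun z => ENNReal.ofReal (1 / ‖z‖)) z + ENNReal.ofReal (c ^ 2 / s) * k z +
      ENNReal.ofReal (M ^ 2 / s) * (pseudoDisc η a)ᶜ.indicator k z +
      ENNReal.ofReal (M ^ 2 / s) * (pseudoDisc η a ∩ superlevel g c).indicator k z := by
    intro z hz
    have hJ := (mobiusJac_pos ha hz).le
    have hW := garsiaWeight_le hβ hz
    have hW0 := weight_nonneg hβ hz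
    rw [(hasDerivAt_intOp hg (differentiableOn_mobiusExt ha) hz).deriv, norm_mul,
      norm_deriv_mobiusExt ha hz]
    have e : (1 - ‖β‖ ^ 2) / ‖1 - conj β * z‖ ^ 2 * (mobiusJac a z * ‖g z‖) ^ 2 *
        Real.log (1 / ‖z‖) = ‖g z‖ ^ 2 * ((1 - ‖β‖ ^ 2) / ‖1 - conj β * z‖ ^ 2 *
        Real.log (1 / ‖z‖)) * mobiusJac a z ^ 2 := by ring
    rw [e]
    set W := (1 - ‖β‖ ^ 2) / ‖1 - conj β * z‖ ^ 2 * Real.log (1 / ‖z‖)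
    have hgM := hM z hz
    rcases lt_or_ge ‖z‖ s with hzs | hzs
    · refine le_add_right (le_add_right (le_add_right ?_))
      rw [indicator_of_mem (mem_ball_zero_iff.2 hzs), ← ENNReal.ofReal_mul (by positivity)]
      apply ENNReal.ofReal_le_ofReal
      calc ‖g z‖ ^ 2 * W * mobiusJac a z ^ 2 ≤ M ^ 2 * (1 / ‖z‖) * 4 ^ 2 := by
            gcongr
            exact mobiusJac_le_four ha (hzs.le.trans hs1)
        _ = _ := by ring
    · have hWs : W ≤ 1 / s := hW.trans (by gcongr)
      have hbound : ∀ B : ℝ, ‖g z‖ ≤ B → ENNReal.ofReal (‖g z‖ ^ 2 * W * mobiusJac a z ^ 2) ≤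
          ENNReal.ofReal (B ^ 2 / s) * k z := fun B hB => by
        rw [hk, ← ENNReal.ofReal_mul (by positivity)]
        apply ENNReal.ofReal_le_ofReal
        calc ‖g z‖ ^ 2 * W * mobiusJac a z ^ 2 ≤ B ^ 2 * (1 / s) * mobiusJac a z ^ 2 := by gcongr
          _ = _ := by ring
      by_cases hzP : z ∈ superlevel g c
      · by_cases hzD : z ∈ pseudoDisc η a
        · refine le_add_left ?_
          rw [indicator_of_mem (show z ∈ pseudoDisc η a ∩ superlevel g c from ⟨hzD, hzP⟩)]
          exact hbound M hgM
        · refine le_add_right (le_add_left ?_)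
          rw [indicator_of_mem hzD]
          exact hbound M hgM
      · refine le_add_right (le_add_right (le_add_left ?_))
        exact hbound c (not_lt.1 fun h => hzP ⟨hz, h⟩)
  calc garsiaIntegral (intOp g (mobiusExt a)) β ≤ ∫⁻ z, (ENNReal.ofReal (16 * M ^ 2) *
        (ball (0 : ℂ) s).indicator (fun z => ENNReal.ofReal (1 / ‖z‖)) z +
        ENNReal.ofReal (c ^ 2 / s) * k z +
        ENNReal.ofReal (M ^ 2 / s) * (pseudoDisc η a)ᶜ.indicator k z +
        ENNReal.ofReal (M ^ 2 / s) * (pseudoDisc η a ∩ superlevel g c).indicator k z) ∂area :=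
        lintegral_mono_ae (ae_area hpt)
    _ = ENNReal.ofReal (16 * M ^ 2) * (∫⁻ z in ball (0 : ℂ) s, ENNReal.ofReal (1 / ‖z‖) ∂area) +
        ENNReal.ofReal (c ^ 2 / s) * 1 + ENNReal.ofReal (M ^ 2 / s) * ENNReal.ofReal (1 - η ^ 2) +
        ENNReal.ofReal (M ^ 2 / s) * area (ball 0 η ∩ mobius a ⁻¹' superlevel g c) := by
        rw [lintegral_add_right _ ((hkm.indicator (hD.inter hP)).const_mul _),
          lintegral_add_right _ ((hkm.indicator hD.compl).const_mul _),
          lintegral_add_right _ (hkm.const_mul _),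
          lintegral_const_mul' _ _ ENNReal.ofReal_ne_top,
          lintegral_const_mul' _ _ ENNReal.ofReal_ne_top,
          lintegral_const_mul' _ _ ENNReal.ofReal_ne_top,
          lintegral_const_mul' _ _ ENNReal.ofReal_ne_top,
          lintegral_indicator measurableSet_ball, lintegral_indicator hD.compl,
          lintegral_indicator (hD.inter hP), area_ball_inter_preimage ha hP,
          setLIntegral_compl_pseudoDisc ha hη0 hη1, lintegral_mobiusJac_sq ha]
    _ ≤ _ := by
        rw [mul_one, ENNReal.ofReal_mul (p := 16 * M ^ 2) (by positivity),
          ENNReal.ofReal_mul (p := M ^ 2 / s) (by positivity)]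
        gcongr
        exact lintegral_ball_one_div_norm_le hs0.le (by linarith)

/-- If `f ↦ ∫ f' g` is bounded below on the automorphisms of the disc, then the superlevel sets of
`g` satisfy the density condition. -/
theorem exists_isRelDense_of_garsiaSup_le {g : ℂ → ℂ} (hg : MemHInf g) {K : ℝ}
    (hK : ∀ a ∈ disc, garsiaSup (mobiusExt a) ≤
      ENNReal.ofReal K * garsiaSup (intOp g (mobiusExt a))) :
    ∃ c δ η : ℝ, 0 < c ∧ 0 < δ ∧ 0 < η ∧ η < 1 ∧ IsRelDense (superlevel g c) δ η := by
  obtain ⟨hgd, M₀, hM₀⟩ := hg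
  obtain ⟨M, hM1, hM⟩ : ∃ M : ℝ, 1 ≤ M ∧ ∀ z ∈ disc, ‖g z‖ ≤ M :=
    ⟨max M₀ 1, le_max_right _ _, fun z hz => (hM₀ z hz).trans (le_max_left _ _)⟩
  obtain ⟨L, hL1, hL⟩ : ∃ L : ℝ, 1 ≤ L ∧ ∀ a ∈ disc,
      ENNReal.ofReal (3 / 32) ≤ ENNReal.ofReal L * garsiaSup (intOp g (mobiusExt a)) :=
    ⟨max K 1, le_max_right _ _, fun a ha => (le_garsiaSup_mobiusExt ha).trans
      ((hK a ha).trans (mul_le_mul' (ENNReal.ofReal_le_ofReal (le_max_left _ _)) le_rfl))⟩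
  have hM2 : 1 ≤ M ^ 2 := one_le_pow₀ hM1
  have hLM : 1 ≤ L * M ^ 2 := one_le_mul_of_one_le_of_one_le hL1 hM2
  -- The parameters `s`, `q` = 1 - η² and `c` make each of the first three terms of the upper bound
  -- equal to 1/(64L). They consume 3/64 of the lower bound 3/32, and the rest forces X ≥ 3q.
  obtain ⟨s, hs⟩ : ∃ s : ℝ, s = 1 / (2048 * (L * M ^ 2)) := ⟨_, rfl⟩
  have hs0 : 0 < s := by rw [hs]; positivity
  have hs1 : s ≤ 1 / 2 := by
    rw [hs, div_le_div_iff₀ (by positivity) (by norm_num)]; linarith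
  obtain ⟨q, hq⟩ : ∃ q : ℝ, q = s / (64 * (L * M ^ 2)) := ⟨_, rfl⟩
  have hq0 : 0 < q := by rw [hq]; positivity
  have hq1 : q < 1 := by
    rw [hq, div_lt_one (by positivity)]; linarith
  set η := √(1 - q) with hη
  have hηsq : η ^ 2 = 1 - q := Real.sq_sqrt (by linarith)
  have hη0 : 0 < η := Real.sqrt_pos.2 (by linarith)
  have hη1 : η < 1 := by nlinarith
  set c := √(s / (64 * L)) with hc
  have hcsq : c ^ 2 = s / (64 * L) := Real.sq_sqrt (by positivity)
  have hc0 : 0 < c := Real.sqrt_pos.2 (by positivity)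
  refine ⟨c, 3 * q * ((q ^ 2 / 4) ^ 2 / 16), η, hc0, by positivity, hη0, hη1, fun a ha => ?_⟩
  have hN := one_sub_norm_sq_pos ha
  have hP := measurableSet_superlevel hgd c
  set X := area (ball 0 η ∩ mobius a ⁻¹' superlevel g c) with hX
  have h1 := (hL a ha).trans (mul_le_mul' le_rfl
    (garsiaSup_intOp_mobiusExt_le hgd hM ha (c := c) hs0 hs1 hη0 hη1))
  have hsum : ENNReal.ofReal (16 * M ^ 2 * (2 * s)) + ENNReal.ofReal (c ^ 2 / s) +
      ENNReal.ofReal (M ^ 2 / s * (1 - η ^ 2)) = ENNReal.ofReal (3 / (64 * L)) := by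
    rw [hηsq, hcsq, ← ENNReal.ofReal_add (by positivity) (by positivity),
      ← ENNReal.ofReal_add (by positivity) (by rw [sub_sub_cancel]; positivity), sub_sub_cancel, hq]
    congr 1
    have : 16 * M ^ 2 * (2 * s) = 1 / (64 * L) := by rw [hs]; field_simp; norm_num
    rw [this]
    field_simp
    norm_num
  rw [hsum, mul_add, ← ENNReal.ofReal_mul (by positivity), ← mul_assoc,
    ← ENNReal.ofReal_mul (by positivity)] at h1
  have hXtop : X ≠ ∞ := measure_ne_top _ _
  have h2 : 3 * q ≤ X.toReal := by
    rw [← hX, ← ENNReal.ofReal_toReal hXtop, ← ENNReal.ofReal_mul (by positivity),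
      ← ENNReal.ofReal_add (by positivity) (by positivity),
      ENNReal.ofReal_le_ofReal_iff (by positivity)] at h1
    have e1 : L * (3 / (64 * L)) = 3 / 64 := by field_simp
    rw [e1] at h1
    have e2 : L * (M ^ 2 / s) * X.toReal = X.toReal / (64 * q) := by
      rw [hq]; field_simp
    rw [e2] at h1
    have h3 : 3 / 64 ≤ X.toReal / (64 * q) := by linarith
    rw [div_le_div_iff₀ (by norm_num) (by positivity)] at h3
    linarith
  have h3 : ENNReal.ofReal (3 * q) ≤ X := by
    rw [← ENNReal.ofReal_toReal hXtop]; exact ENNReal.ofReal_le_ofReal h2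
  -- The lower bound for X is carried back to D_η(a). Since φ_a maps D_η(a) into a set of area at
  -- most 1, the area of D_η(a) is at most of order (1 - |a|²)², so the factors 1 - |a|² cancel.
  have h4 := h3.trans (area_ball_inter_preimage_le ha hP)
  have h5 := le_area_ball_inter_preimage ha hη1 MeasurableSet.univ
  rw [preimage_univ, inter_univ, inter_univ] at h5
  have h6 := h5.trans prob_le_one
  rw [hηsq, sub_sub_cancel] at h6
  set N := 1 - ‖a‖ ^ 2
  calc ENNReal.ofReal (3 * q * ((q ^ 2 / 4) ^ 2 / 16)) * area (pseudoDisc η a)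
      = ENNReal.ofReal (3 * q) * ENNReal.ofReal ((N / 4) ^ 2) *
          (ENNReal.ofReal ((q ^ 2 / 4 / N) ^ 2) * area (pseudoDisc η a)) := by
        rw [← mul_assoc, ← ENNReal.ofReal_mul (by positivity), ← ENNReal.ofReal_mul (by positivity)]
        congr 2
        field_simp
        norm_num
    _ ≤ ENNReal.ofReal ((4 / N) ^ 2) * area (pseudoDisc η a ∩ superlevel g c) *
          ENNReal.ofReal ((N / 4) ^ 2) * 1 := by gcongr
    _ = ENNReal.ofReal ((4 / N) ^ 2 * (N / 4) ^ 2) * area (superlevel g c ∩ pseudoDisc η a) := by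
        rw [mul_one, mul_right_comm, ← ENNReal.ofReal_mul (by positivity), inter_comm]
    _ = _ := by
        rw [← mul_pow, div_mul_div_comm, mul_comm 4 N, div_self (by positivity), one_pow,
          ENNReal.ofReal_one, one_mul]

/-! ### Completeness of BMOA and the quotient norm. -/

open Filter in
-- Fatou's lemma for each β. This lower semicontinuity makes the limit of a Cauchy sequence belong
-- to BMOA, and makes the convergence hold in norm.
theorem garsiaSup_le_of_tendsto {w : ℕ → ℂ → ℂ} {F : ℂ → ℂ} {b : ℝ≥0∞}
    (hd : ∀ z ∈ disc, Tendsto (fun n => deriv (w n) z) atTop (nhds (deriv F z)))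
    (hb : ∀ᶠ n in atTop, garsiaSup (w n) ≤ b) : garsiaSup F ≤ b := by
  refine iSup₂_le fun β hβ => ?_
  set I : (ℂ → ℂ) → ℂ → ℝ≥0∞ := fun f z => ENNReal.ofReal ((1 - ‖β‖ ^ 2) /
    ‖1 - conj β * z‖ ^ 2 * ‖deriv f z‖ ^ 2 * Real.log (1 / ‖z‖)) with hI
  have hm : ∀ n, Measurable (I (w n)) := fun n => by
    have := measurable_deriv (w n)
    simp only [hI]
    fun_prop
  calc garsiaIntegral F β = ∫⁻ z, liminf (fun n => I (w n) z) atTop ∂area := by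
        refine lintegral_congr_ae (ae_area fun z hz => ?_)
        refine (Tendsto.liminf_eq ?_).symm
        refine (ENNReal.continuous_ofReal.tendsto _).comp ?_
        exact ((((hd z hz).norm).pow 2).const_mul _).mul_const _
    _ ≤ liminf (fun n => ∫⁻ z, I (w n) z ∂area) atTop := lintegral_liminf_le hm
    _ ≤ b := by
        refine liminf_le_of_frequently_le' (Eventually.frequently ?_)
        filter_upwards [hb] with n hn using (garsiaIntegral_le_garsiaSup (w n) hβ).trans hn

theorem garsiaSup_congr {f h : ℂ → ℂ} (H : ∀ z ∈ disc, deriv f z = deriv h z) :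
    garsiaSup f = garsiaSup h := by
  have h1 := garsiaSup_le_mul (M := 1) (F := f) (f := h) fun z hz => by rw [H z hz, one_mul]
  have h2 := garsiaSup_le_mul (M := 1) (F := h) (f := f) fun z hz => by rw [H z hz, one_mul]
  simp only [one_pow, ENNReal.ofReal_one, one_mul] at h1 h2
  exact le_antisymm h1 h2

theorem BMOA.norm_sq (f : BMOA) : ‖f‖ ^ 2 = ‖f.fn 0‖ ^ 2 + (garsiaSup f.fn).toReal := by
  rw [norm_def, Real.sq_sqrt (by positivity)]

theorem BMOA.garsiaSup_le (f : BMOA) : garsiaSup f.fn ≤ ENNReal.ofReal (‖f‖ ^ 2) := by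
  rw [f.norm_sq, ← ENNReal.ofReal_toReal f.garsiaSup_lt_top.ne]
  apply ENNReal.ofReal_le_ofReal
  rw [ENNReal.toReal_ofReal ENNReal.toReal_nonneg]
  linarith [sq_nonneg ‖f.fn 0‖]

theorem BMOA.norm_fn_zero_le (f : BMOA) : ‖f.fn 0‖ ≤ ‖f‖ := by
  refine le_of_sq_le_sq ?_ (norm_nonneg f)
  rw [f.norm_sq]
  linarith [ENNReal.toReal_nonneg (a := garsiaSup f.fn)]

theorem BMOA.fn_sub (f h : BMOA) : (f - h).fn = f.fn - h.fn := rfl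

/-- Point evaluations are bounded on BMOA, locally uniformly. -/
theorem BMOA.exists_norm_fn_le {r : ℝ} (hr : r < 1) :
    ∃ B : ℝ, 0 < B ∧ ∀ (f : BMOA) (z : ℂ), ‖z‖ ≤ r → ‖f.fn z‖ ≤ B * ‖f‖ := by
  obtain ⟨C, hC, H⟩ := exists_norm_sq_le_bergmanIntegral hr
  refine ⟨1 + √(C * 2), by positivity, fun f z hz => ?_⟩
  have hsub : closedBall (0 : ℂ) r ⊆ disc := closedBall_subset_ball hr
  have h0 : (0 : ℂ) ∈ disc := by simp
  -- For β = 0 the function `garsiaFun` is f' itself, so f' is bounded on compact sets; the mean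
  -- value inequality from 0 then bounds f.
  have hderiv : ∀ a ∈ closedBall (0 : ℂ) r, ‖deriv f.fn a‖ ≤ √(C * 2) * ‖f‖ := by
    intro a ha
    have h1 := H (garsiaFun f.fn 0) (differentiableOn_garsiaFun f.differentiableOn h0) a
      (mem_closedBall_zero_iff.1 ha)
    rw [norm_garsiaFun_sq _ h0] at h1
    have h2 : bergmanIntegral (garsiaFun f.fn 0) ≤ ENNReal.ofReal 2 * ENNReal.ofReal (‖f‖ ^ 2) := by
      refine (bergmanIntegral_le_logIntegral _).trans ?_
      rw [← garsiaIntegral_eq_logIntegral _ h0]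
      gcongr
      exact (garsiaIntegral_le_garsiaSup _ h0).trans f.garsiaSup_le
    have h3 := h1.trans (mul_le_mul' le_rfl h2)
    rw [← ENNReal.ofReal_mul zero_le_two, ← ENNReal.ofReal_mul hC.le,
      ENNReal.ofReal_le_ofReal_iff (by positivity)] at h3
    refine le_of_sq_le_sq ?_ (by positivity)
    rw [mul_pow, Real.sq_sqrt (by positivity)]
    simpa [mul_assoc] using h3
  have h4 := (convex_closedBall (0 : ℂ) r).norm_image_sub_le_of_norm_deriv_le
    (fun a ha => f.differentiableOn.differentiableAt (isOpen_ball.mem_nhds (hsub ha))) hderiv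
    (mem_closedBall_self ((norm_nonneg z).trans hz)) (mem_closedBall_zero_iff.2 hz)
  rw [sub_zero] at h4
  have h5 : √(C * 2) * ‖f‖ * ‖z‖ ≤ √(C * 2) * ‖f‖ :=
    mul_le_of_le_one_right (by positivity) (hz.trans hr.le)
  calc ‖f.fn z‖ ≤ ‖f.fn 0‖ + ‖f.fn z - f.fn 0‖ := by
        simpa using norm_add_le (f.fn 0) (f.fn z - f.fn 0)
    _ ≤ ‖f‖ + √(C * 2) * ‖f‖ := add_le_add f.norm_fn_zero_le (h4.trans h5)
    _ = _ := by ring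

theorem BMOA.exists_norm_fn_le_mul (z : ℂ) : ∃ B : ℝ, ∀ f : BMOA, ‖f.fn z‖ ≤ B * ‖f‖ := by
  by_cases hz : z ∈ disc
  · obtain ⟨B, -, hB⟩ := BMOA.exists_norm_fn_le (mem_ball_zero_iff.1 hz)
    exact ⟨B, fun f => hB f z le_rfl⟩
  · exact ⟨0, fun f => by simp [f.fn_eq_zero z hz]⟩

theorem BMOA.continuous_fn (z : ℂ) : Continuous fun f : BMOA => f.fn z := by
  obtain ⟨B, hB⟩ := BMOA.exists_norm_fn_le_mul z
  let φ : BMOA →ₗ[ℂ] ℂ :=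
    { toFun := fun f => f.fn z, map_add' := fun _ _ => rfl, map_smul' := fun _ _ => rfl }
  exact (φ.mkContinuous B hB).continuous

open Filter in
-- Norm-Cauchy sequences converge locally uniformly, so the limit is analytic and the derivatives
-- converge. Completeness is what allows the open mapping theorem to be used on the quotient.
instance : CompleteSpace BMOA := by
  refine Metric.complete_of_cauchySeq_tendsto fun u hu => ?_
  have hcauchy : ∀ ε > 0, ∃ N, ∀ m ≥ N, ∀ n ≥ N, ‖u m - u n‖ < ε := by
    simpa only [dist_eq_norm] using Metric.cauchySeq_iff.1 hu
  have hpt : ∀ z, ∃ y, Tendsto (fun n => (u n).fn z) atTop (nhds y) := by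
    intro z
    obtain ⟨B, hB⟩ := BMOA.exists_norm_fn_le_mul z
    refine cauchySeq_tendsto_of_complete ?_
    let φ : BMOA →ₗ[ℂ] ℂ :=
      { toFun := fun f => f.fn z, map_add' := fun _ _ => rfl, map_smul' := fun _ _ => rfl }
    exact (φ.mkContinuous B hB).uniformContinuous.comp_cauchySeq hu
  choose F hF using hpt
  have hunif : TendstoLocallyUniformlyOn (fun n => (u n).fn) F atTop disc := by
    refine tendstoLocallyUniformlyOn_of_forall_exists_nhds fun x hx => ?_
    rw [mem_ball_zero_iff] at hx
    obtain ⟨r, hxr, hr⟩ := exists_between hx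
    obtain ⟨B, hB0, hB⟩ := BMOA.exists_norm_fn_le hr
    refine ⟨ball 0 r, mem_nhdsWithin_of_mem_nhds
      (isOpen_ball.mem_nhds (mem_ball_zero_iff.2 hxr)), ?_⟩
    refine UniformCauchySeqOn.tendstoUniformlyOn_of_tendsto ?_ fun z _ => hF z
    refine Metric.uniformCauchySeqOn_iff.2 fun ε hε => ?_
    obtain ⟨N, hN⟩ := hcauchy (ε / B) (by positivity)
    refine ⟨N, fun m hm n hn z hz => ?_⟩
    rw [dist_eq_norm]
    calc ‖(u m).fn z - (u n).fn z‖ ≤ B * ‖u m - u n‖ := hB (u m - u n) z (mem_ball_zero_iff.1 hz).le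
      _ < B * (ε / B) := by gcongr; exact hN m hm n hn
      _ = ε := by field_simp
  have hdiff : ∀ᶠ n in (atTop : Filter ℕ), DifferentiableOn ℂ (u n).fn disc :=
    Eventually.of_forall fun n => (u n).differentiableOn
  have hFd : DifferentiableOn ℂ F disc := hunif.differentiableOn hdiff isOpen_ball
  have hderiv : ∀ z ∈ disc, Tendsto (fun n => deriv (u n).fn z) atTop (nhds (deriv F z)) :=
    fun z hz => (hunif.deriv hdiff isOpen_ball).tendsto_at hz
  have hF0 : ∀ z, z ∉ disc → F z = 0 := fun z hz =>
    tendsto_nhds_unique (hF z) (by simp [BMOA.fn_eq_zero _ z hz])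
  have hsup : ∀ ε > 0, ∃ N, ∀ m ≥ N, garsiaSup (F - (u m).fn) ≤ ENNReal.ofReal (ε ^ 2) := by
    intro ε hε
    obtain ⟨N, hN⟩ := hcauchy ε hε
    refine ⟨N, fun m hm => garsiaSup_le_of_tendsto (w := fun n => (u n - u m).fn) ?_ ?_⟩
    · intro z hz
      have hn := isOpen_ball.mem_nhds hz
      have hd := fun n => (u n).differentiableOn.differentiableAt hn
      simp_rw [BMOA.fn_sub]
      rw [deriv_sub (hFd.differentiableAt hn) (hd m)]
      simp_rw [deriv_sub (hd _) (hd m)]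
      exact (hderiv z hz).sub_const _
    · filter_upwards [eventually_ge_atTop N] with n hn
      refine (u n - u m).garsiaSup_le.trans (ENNReal.ofReal_le_ofReal ?_)
      exact pow_le_pow_left₀ (norm_nonneg _) (hN n hn m hm).le 2
  -- F is the sum of F - u_N, which has finite seminorm by Fatou, and u_N.
  have hmem : F ∈ bmoaSubmodule := by
    obtain ⟨N, hN⟩ := hsup 1 one_pos
    have h1 : F - (u N).fn ∈ bmoaSubmodule :=
      ⟨hFd.sub (u N).differentiableOn, fun z hz => by simp [hF0 z hz, (u N).fn_eq_zero z hz],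
        (hN N le_rfl).trans_lt ENNReal.ofReal_lt_top⟩
    simpa using bmoaSubmodule.add_mem h1 (u N).mem
  refine ⟨BMOA.ofFun F hmem, tendsto_iff_norm_sub_tendsto_zero.2 ?_⟩
  have hsq : Tendsto (fun n => ‖u n - BMOA.ofFun F hmem‖ ^ 2) atTop (nhds 0) := by
    have e : ∀ n, ‖u n - BMOA.ofFun F hmem‖ ^ 2 =
        ‖(u n).fn 0 - F 0‖ ^ 2 + (garsiaSup (F - (u n).fn)).toReal := by
      intro n
      rw [norm_sub_rev, BMOA.norm_sq, norm_sub_rev]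
      rfl
    simp_rw [e]
    have h1 : Tendsto (fun n => ‖(u n).fn 0 - F 0‖ ^ 2) atTop (nhds 0) := by
      simpa using (tendsto_iff_norm_sub_tendsto_zero.1 (hF 0)).pow 2
    have h2 : Tendsto (fun n => (garsiaSup (F - (u n).fn)).toReal) atTop (nhds 0) := by
      refine Metric.tendsto_atTop.2 fun ε hε => ?_
      obtain ⟨N, hN⟩ := hsup (√(ε / 2)) (by positivity)
      refine ⟨N, fun n hn => ?_⟩
      rw [Real.dist_0_eq_abs, abs_of_nonneg ENNReal.toReal_nonneg]
      have := ENNReal.toReal_mono ENNReal.ofReal_ne_top (hN n hn)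
      rw [ENNReal.toReal_ofReal (by positivity), Real.sq_sqrt (by positivity)] at this
      linarith
    simpa using h1.add h2
  simpa [Real.sqrt_sq (norm_nonneg _)] using hsq.sqrt

/-- Closedness makes the quotient seminorm on BMOA₀ a norm. -/
instance isClosed_constants : IsClosed (constants : Set BMOA) := by
  have h : (constants : Set BMOA) = ⋂ z ∈ disc, {f : BMOA | f.fn z = f.fn 0} := by
    ext f
    simp only [mem_iInter, mem_ofPred_eq]
    constructor
    · rintro ⟨c, hc⟩ z hz
      rw [hc z hz, hc 0 (by simp)]
    · exact fun h => ⟨f.fn 0, h⟩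
  rw [h]
  exact isClosed_biInter fun z _ => isClosed_eq (BMOA.continuous_fn z) (BMOA.continuous_fn 0)

theorem deriv_eq_zero_of_mem_constants {f : BMOA} (hf : f ∈ constants) {z : ℂ} (hz : z ∈ disc) :
    deriv f.fn z = 0 := by
  obtain ⟨c, hc⟩ := hf
  have : f.fn =ᶠ[nhds z] fun _ => c := by
    filter_upwards [isOpen_ball.mem_nhds hz] with w hw using hc w hw
  rw [this.deriv_eq, deriv_const]

theorem mem_constants_of_deriv_eq_zero {f : BMOA} (hf : ∀ z ∈ disc, deriv f.fn z = 0) :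
    f ∈ constants :=
  ⟨f.fn 0, fun _ hz => isOpen_ball.is_const_of_deriv_eq_zero
    (convex_ball (0 : ℂ) 1).isPreconnected f.differentiableOn hf hz (by simp)⟩

theorem deriv_fn_sub (f h : BMOA) {z : ℂ} (hz : z ∈ disc) :
    deriv (f - h).fn z = deriv f.fn z - deriv h.fn z := by
  have hn := isOpen_ball.mem_nhds hz
  rw [BMOA.fn_sub, deriv_sub (f.differentiableOn.differentiableAt hn)
    (h.differentiableOn.differentiableAt hn)]

/-- The norm of `BMOA₀` is the square root of the supremum of the weighted area integrals. -/
theorem norm_mk_sq (f : BMOA) :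
    ‖(Submodule.Quotient.mk f : BMOA₀)‖ ^ 2 = (garsiaSup f.fn).toReal := by
  apply le_antisymm
  -- The representative f - f(0) has no point-value term, so its squared norm is exactly the
  -- supremum.
  · let k : ℂ → ℂ := disc.indicator fun _ => f.fn 0
    have hk : ∀ z ∈ disc, HasDerivAt k 0 z := fun z hz => by
      refine (hasDerivAt_const z (f.fn 0)).congr_of_eventuallyEq ?_
      filter_upwards [isOpen_ball.mem_nhds hz] with w hw using indicator_of_mem hw _
    have hkm : k ∈ bmoaSubmodule := by
      refine ⟨fun z hz => (hk z hz).differentiableAt.differentiableWithinAt,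
        fun z hz => indicator_of_notMem hz _, ?_⟩
      rw [garsiaSup_congr (h := 0) fun z hz => by rw [(hk z hz).deriv]; simp [Pi.zero_def],
        garsiaSup_zero]
      exact ENNReal.zero_lt_top
    have hkc : BMOA.ofFun k hkm ∈ constants := ⟨f.fn 0, fun z hz => by
      rw [BMOA.fn_ofFun]; exact indicator_of_mem hz _⟩
    have e : (Submodule.Quotient.mk f : BMOA₀) =
        Submodule.Quotient.mk (f - BMOA.ofFun k hkm) := by
      rw [Submodule.Quotient.eq, sub_sub_cancel]
      exact hkc
    have hle : ‖(Submodule.Quotient.mk f : BMOA₀)‖ ≤ ‖f - BMOA.ofFun k hkm‖ := by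
      rw [e]; exact Submodule.Quotient.norm_mk_le _ _
    refine (pow_le_pow_left₀ (norm_nonneg _) hle 2).trans ?_
    rw [BMOA.norm_sq]
    have e0 : (f - BMOA.ofFun k hkm).fn 0 = 0 := by
      rw [BMOA.fn_sub, BMOA.fn_ofFun, Pi.sub_apply, sub_eq_zero]
      exact (indicator_of_mem (by simp) _).symm
    rw [e0, norm_zero, zero_pow two_ne_zero, zero_add]
    apply le_of_eq
    congr 1
    refine garsiaSup_congr fun z hz => ?_
    rw [deriv_fn_sub _ _ hz, deriv_eq_zero_of_mem_constants hkc hz, sub_zero]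
  -- All representatives of a class have the same derivative, so each has squared norm at least the
  -- common supremum.
  · have h : √(garsiaSup f.fn).toReal ≤ ‖(Submodule.Quotient.mk f : BMOA₀)‖ := by
      refine le_of_forall_pos_le_add fun ε hε => ?_
      obtain ⟨m, hm, hlt⟩ := Submodule.Quotient.norm_mk_lt (Submodule.Quotient.mk f : BMOA₀) hε
      rw [Submodule.Quotient.eq] at hm
      have e : garsiaSup f.fn = garsiaSup m.fn := garsiaSup_congr fun z hz => by
        have := deriv_eq_zero_of_mem_constants hm hz
        rw [deriv_fn_sub _ _ hz, sub_eq_zero] at this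
        exact this.symm
      refine le_trans ?_ hlt.le
      rw [Real.sqrt_le_left (norm_nonneg _), m.norm_sq, e]
      linarith [sq_nonneg ‖m.fn 0‖]
    exact (Real.sqrt_le_left (norm_nonneg _)).1 h

/-! ### Closed range and boundedness below. -/

theorem Sg₀_mk (g : ℂ → ℂ) (hg : MemHInf g) (f : BMOA) :
    Sg₀ g hg (Submodule.Quotient.mk f) = Submodule.Quotient.mk (Sg g hg f) := rfl

theorem fn_Sg (g : ℂ → ℂ) (hg : MemHInf g) (f : BMOA) : (Sg g hg f).fn = intOp g f.fn := rfl

/-- A vanishing product f'g of analytic functions on a connected set has a vanishing factor, and g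
is not identically zero. Injectivity is what makes closed range equivalent to a lower bound on the
whole space. -/
theorem Sg₀_injective {g : ℂ → ℂ} (hg : MemHInf g) (hg0 : ∃ z ∈ disc, g z ≠ 0) :
    Function.Injective (Sg₀ g hg) := by
  refine (injective_iff_map_eq_zero _).2 fun x hx => ?_
  obtain ⟨f, rfl⟩ := Submodule.Quotient.mk_surjective _ x
  rw [Sg₀_mk, Submodule.Quotient.mk_eq_zero] at hx
  rw [Submodule.Quotient.mk_eq_zero]
  have hzero : ∀ z ∈ disc, deriv f.fn z * g z = 0 := fun z hz => by
    rw [← (hasDerivAt_intOp hg.1 f.differentiableOn hz).deriv, ← fn_Sg g hg]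
    exact deriv_eq_zero_of_mem_constants hx hz
  rcases AnalyticOnNhd.eq_zero_or_eq_zero_of_mul_eq_zero
    ((f.differentiableOn.deriv isOpen_ball).analyticOnNhd isOpen_ball)
    (hg.1.analyticOnNhd isOpen_ball) hzero (convex_ball (0 : ℂ) 1).isPreconnected with h | h
  · exact mem_constants_of_deriv_eq_zero h
  · obtain ⟨z, hz, hne⟩ := hg0
    exact absurd (h z hz) hne

/-- The operator `S_g` on `BMOA₀` has closed range if and only if it is bounded below. -/
theorem isClosed_range_Sg₀_iff {g : ℂ → ℂ} (hg : MemHInf g) (hg0 : ∃ z ∈ disc, g z ≠ 0) :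
    IsClosed (range (Sg₀ g hg)) ↔ ∃ K : ℝ, ∀ f : BMOA,
      garsiaSup f.fn ≤ ENNReal.ofReal K * garsiaSup (intOp g f.fn) := by
  obtain ⟨M, hM0, hM⟩ : ∃ M : ℝ, 0 ≤ M ∧ ∀ z ∈ disc, ‖g z‖ ≤ M := by
    obtain ⟨M, hM⟩ := hg.2
    exact ⟨M, (norm_nonneg _).trans (hM 0 (by simp)), hM⟩
  have hfin : ∀ f : BMOA, garsiaSup (intOp g f.fn) ≠ ∞ := fun f =>
    (Sg g hg f).garsiaSup_lt_top.ne
  have hbound : ∀ x, ‖Sg₀ g hg x‖ ≤ M * ‖x‖ := by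
    intro x
    obtain ⟨f, rfl⟩ := Submodule.Quotient.mk_surjective _ x
    refine le_of_sq_le_sq ?_ (by positivity)
    rw [Sg₀_mk, mul_pow, norm_mk_sq, norm_mk_sq, fn_Sg]
    have h := garsiaSup_le_mul (F := intOp g f.fn) (f := f.fn) (M := M) fun z hz => by
      rw [(hasDerivAt_intOp hg.1 f.differentiableOn hz).deriv, norm_mul, mul_comm]
      exact mul_le_mul_of_nonneg_right (hM z hz) (norm_nonneg _)
    have h2 := ENNReal.toReal_mono
      (ENNReal.mul_ne_top ENNReal.ofReal_ne_top f.garsiaSup_lt_top.ne) h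
    rwa [ENNReal.toReal_mul, ENNReal.toReal_ofReal (by positivity)] at h2
  let T : BMOA₀ →L[ℂ] BMOA₀ := (Sg₀ g hg).mkContinuous M hbound
  have key := T.isClosed_range_iff_antilipschitz_of_injective (Sg₀_injective hg hg0)
  refine key.trans ⟨?_, ?_⟩
  · rintro ⟨K, hK⟩
    refine ⟨(K : ℝ) ^ 2, fun f => ?_⟩
    have h1 : ‖(Submodule.Quotient.mk f : BMOA₀)‖ ≤
        K * ‖(Submodule.Quotient.mk (Sg g hg f) : BMOA₀)‖ :=
      T.bound_of_antilipschitz hK (Submodule.Quotient.mk f)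
    have h2 := pow_le_pow_left₀ (norm_nonneg _) h1 2
    rw [mul_pow, norm_mk_sq, norm_mk_sq, fn_Sg] at h2
    rw [← ENNReal.ofReal_toReal f.garsiaSup_lt_top.ne, ← ENNReal.ofReal_toReal (hfin f),
      ← ENNReal.ofReal_mul (by positivity)]
    exact ENNReal.ofReal_le_ofReal h2
  · rintro ⟨K, hK⟩
    -- The square root appears because `garsiaSup` is the square of the quotient norm; the maximum
    -- covers a negative `K`.
    refine ⟨⟨√(max K 0), Real.sqrt_nonneg _⟩, T.antilipschitz_of_bound fun x => ?_⟩
    obtain ⟨f, rfl⟩ := Submodule.Quotient.mk_surjective _ x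
    refine le_of_sq_le_sq ?_ (mul_nonneg (NNReal.coe_nonneg _) (norm_nonneg _))
    change ‖(Submodule.Quotient.mk f : BMOA₀)‖ ^ 2 ≤
      (√(max K 0) * ‖(Submodule.Quotient.mk (Sg g hg f) : BMOA₀)‖) ^ 2
    rw [mul_pow, Real.sq_sqrt (le_max_right _ _), norm_mk_sq, norm_mk_sq, fn_Sg]
    have h1 : garsiaSup f.fn ≤ ENNReal.ofReal (max K 0) * garsiaSup (intOp g f.fn) :=
      (hK f).trans (by gcongr; exact le_max_left _ _)
    have h2 := ENNReal.toReal_mono (ENNReal.mul_ne_top ENNReal.ofReal_ne_top (hfin f)) h1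
    rwa [ENNReal.toReal_mul, ENNReal.toReal_ofReal (le_max_right _ _)] at h2

end ClosedRange

theorem theorem3p1 (g : ℂ → ℂ) (hg : ClosedRange.MemHInf g)
    (hg0 : ∃ z ∈ ClosedRange.disc, g z ≠ 0) :
    IsClosed (Set.range (ClosedRange.Sg₀ g hg)) ↔
      ∃ c δ η : ℝ, 0 < c ∧ 0 < δ ∧ 0 < η ∧ η < 1 ∧ ∀ a ∈ ClosedRange.disc,
        ENNReal.ofReal δ * ClosedRange.area (ClosedRange.pseudoDisc η a) ≤
          ClosedRange.area (ClosedRange.superlevel g c ∩ ClosedRange.pseudoDisc η a) := by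
  rw [ClosedRange.isClosed_range_Sg₀_iff hg hg0]
  constructor
  · rintro ⟨K, hK⟩
    refine ClosedRange.exists_isRelDense_of_garsiaSup_le hg fun a ha => hK (ClosedRange.BMOA.ofFun
      (ClosedRange.mobiusExt a) ⟨ClosedRange.differentiableOn_mobiusExt ha,
        fun z hz => Set.indicator_of_notMem hz _, ClosedRange.garsiaSup_mobiusExt_lt_top ha⟩)
  · rintro ⟨c, δ, η, hc, hδ, hη0, hη1, hd⟩
    obtain ⟨K, -, hK⟩ := ClosedRange.exists_garsiaSup_le_of_isRelDense hg.1 hc hδ hη0 hη1 hd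
    exact ⟨K, fun f => hK f.fn f.differentiableOn f.garsiaSup_lt_top⟩
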